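/- For $q\in\mathbb{C}$ with $|q|<1$ write $(a;q)_n=\prod_{k=0}^{n-1}(1-aq^k)$, $(a;q)_\infty=\prod_{k\ge 0}(1-aq^k)$, and, for integers $0<a<m$, $$J_m=(q^m;q^m)_\infty,\qquad J_{a,m}=(q^a;q^m)_\infty(q^{m-a};q^m)_\infty(q^m;q^m)_\infty .$$ For $u,v,w,t\in\mathbb{C}$ let $$F(u,v,w,t;q^2)=\sum_{i,j,k,l\ge 0}\frac{u^iv^jw^kt^l\,q^{i^2+j^2+k^2+l^2+(i-j-k)l}}{(q^2;q^2)_i(q^2;q^2)_j(q^2;q^2)_k(q^2;q^2)_l}.$$ Then for every $q\in\mathbb{C}$ with $|q|<1$ the series defining $F(u,v,w,t;q^2)$ converges absolutely for all $u,v,w,t\in\mathbb{C}$, and \begin{align*} F(u,v,w,t;q^2)&=F(u,w,v,t;q^2)\qquad\text{for all } u,v,w,t\in\mathbb{C},\\ F(1,1,1,1;q^2)&=\frac{J_2^6J_{14}J_{28}^5}{J_1^3J_4^3J_{2,28}J_{3,28}J_{7,28}J_{8,28}J_{11,28}J_{12,28}}+4q\frac{J_4^3J_{8,28}}{J_2^4},\\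 F(1,1,1,q;q^2)&=\frac{J_2^6J_{14}J_{28}^5}{J_1^3J_4^3J_{4,28}J_{5,28}J_{6,28}J_{7,28}J_{8,28}J_{9,28}}+4q^2\frac{J_4^3J_{4,28}}{J_2^4}, \end{align*} and, if moreover $q\neq 0$, $$F(q^{-1},q,q^{-1},1;q^2)=4\frac{J_4^3J_{12,28}}{J_2^4}+\frac{J_2^6J_{14}J_{28}^5}{J_1^3J_4^3J_{1,28}J_{4,28}J_{7,28}J_{10,28}J_{12,28}J_{13,28}}.$$ -/

import Mathlib

noncomputable section

namespace QSeries

/-- The finite `q`-shifted factorial `(a; q)_n = ∏_{0 ≤ k < n} (1 - a q^k)`. -/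
def qPoch (a q : ℂ) (n : ℕ) : ℂ :=
  ∏ k ∈ Finset.range n, (1 - a * q ^ k)

/-- The infinite `q`-shifted factorial `(a; q)_∞ = ∏_{k ≥ 0} (1 - a q^k)`, for `‖q‖ < 1`. -/
def qPochInf (a q : ℂ) : ℂ :=
  ∏' k : ℕ, (1 - a * q ^ k)

/-- `J_m = (q^m; q^m)_∞`. -/
def J (q : ℂ) (m : ℕ) : ℂ :=
  qPochInf (q ^ m) (q ^ m)

/-- `J_{a,m} = (q^a, q^{m-a}, q^m; q^m)_∞`, for `0 < a < m`. -/
def Jpair (q : ℂ) (a m : ℕ) : ℂ :=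
  qPochInf (q ^ a) (q ^ m) * qPochInf (q ^ (m - a)) (q ^ m) * qPochInf (q ^ m) (q ^ m)

/-- The general term, at `n = (i, j, k, l)`, of the series `F(u, v, w, t; q²)`. The exponent
`i² + j² + k² + l² + (i - j - k) l` of `q` is computed in `ℤ`. -/
def termF (u v w t q : ℂ) (n : ℕ × ℕ × ℕ × ℕ) : ℂ :=
  (u ^ n.1 * v ^ n.2.1 * w ^ n.2.2.1 * t ^ n.2.2.2 *
      q ^ ((n.1 : ℤ) ^ 2 + (n.2.1 : ℤ) ^ 2 + (n.2.2.1 : ℤ) ^ 2 + (n.2.2.2 : ℤ) ^ 2 +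
        ((n.1 : ℤ) - (n.2.1 : ℤ) - (n.2.2.1 : ℤ)) * (n.2.2.2 : ℤ))) /
    (qPoch (q ^ 2) (q ^ 2) n.1 * qPoch (q ^ 2) (q ^ 2) n.2.1 *
      qPoch (q ^ 2) (q ^ 2) n.2.2.1 * qPoch (q ^ 2) (q ^ 2) n.2.2.2)

/-- `F(u, v, w, t; q²)`, the sum over all `i, j, k, l ≥ 0`, as a function of `u, v, w, t`
and `q`. -/
def F (u v w t q : ℂ) : ℂ :=
  ∑' n : ℕ × ℕ × ℕ × ℕ, termF u v w t q n

end QSeries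

end

/-!
For fixed `l`, Euler's identity `∑ z ^ i y ^ (i ^ 2) / (y²; y²)_i = (-z y; y²)_∞` sums the series
over `i`, `j` and `k`. When `u`, `v`, `w` are powers of `q`, this leaves products `(-q ^ n; q²)_∞`
in which `n` moves with `l`. Within a parity class of `l`, the products from `i` and `j` together
form a theta function, so they depend on `l` only through a power of `q`, and the product from `k`
contributes a finite factor. One parity class then is a Rogers–Selberg series (modulus 7) at `-q`,
the other a Rogers series (modulus 14) at `q²`.

Both kinds of series follow from the limiting case of Bailey's lemma: the Durfee rectangle identity
sums `α r p ^ (n ^ 2) / ((p; p)_{n - r} (p; p)_{n + r})` over `n`, and the Jacobi triple product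
evaluates the remaining theta series. The `β`-sequences are found from first-order recurrences,
which come from the symmetries `r ↦ -r` and `r ↦ r - 1` of the theta terms `α r`. Finally, `q ↦ -q`
turns the products modulo 7 into products modulo 28.
-/

namespace QSeries

open Filter Topology

section ShiftedFactorials

variable {p : ℂ}

lemma norm_pow_lt_one (hp : ‖p‖ < 1) {n : ℕ} (hn : n ≠ 0) : ‖p ^ n‖ < 1 := by
  rw [norm_pow]
  exact pow_lt_one₀ (norm_nonneg _) hp hn

lemma norm_mul_pow_lt_one {a : ℂ} (ha : ‖a‖ < 1) (hp : ‖p‖ < 1) (k : ℕ) : ‖a * p ^ k‖ < 1 := by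
  rw [norm_mul, norm_pow]
  exact (mul_le_of_le_one_right (norm_nonneg _) (pow_le_one₀ (norm_nonneg _) hp.le)).trans_lt ha

lemma one_sub_ne_zero_of_norm_lt_one {a : ℂ} (ha : ‖a‖ < 1) : 1 - a ≠ 0 :=
  (isUnit_one_sub_of_norm_lt_one ha).ne_zero

lemma summable_norm_neg_mul_pow (a : ℂ) (hp : ‖p‖ < 1) :
    Summable fun k : ℕ => ‖-(a * p ^ k)‖ := by
  simp only [norm_neg, norm_mul, norm_pow]
  exact (summable_geometric_of_lt_one (norm_nonneg _) hp).mul_left _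

lemma tendsto_qPoch (a : ℂ) (hp : ‖p‖ < 1) :
    Tendsto (qPoch a p) atTop (𝓝 (qPochInf a p)) := by
  have : Multipliable fun k : ℕ => 1 - a * p ^ k := by
    simpa [sub_eq_add_neg] using
      multipliable_one_add_of_summable (summable_norm_neg_mul_pow a hp)
  exact this.hasProd.tendsto_prod_nat

lemma qPoch_ne_zero {a : ℂ} (ha : ‖a‖ < 1) (hp : ‖p‖ < 1) (n : ℕ) : qPoch a p n ≠ 0 :=
  Finset.prod_ne_zero_iff.2 fun k _ =>
    one_sub_ne_zero_of_norm_lt_one (norm_mul_pow_lt_one ha hp k)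

lemma qPochInf_ne_zero {a : ℂ} (ha : ‖a‖ < 1) (hp : ‖p‖ < 1) : qPochInf a p ≠ 0 := by
  have := tprod_one_add_ne_zero_of_summable (f := fun k : ℕ => -(a * p ^ k))
    (fun k => by
      simpa [sub_eq_add_neg] using one_sub_ne_zero_of_norm_lt_one (norm_mul_pow_lt_one ha hp k))
    (summable_norm_neg_mul_pow a hp)
  simpa [qPochInf, sub_eq_add_neg] using this

@[simp] lemma qPoch_zero (a p : ℂ) : qPoch a p 0 = 1 := by simp [qPoch]

lemma qPoch_succ (a p : ℂ) (n : ℕ) : qPoch a p (n + 1) = qPoch a p n * (1 - a * p ^ n) :=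
  Finset.prod_range_succ _ _

lemma qPoch_add (a p : ℂ) (m n : ℕ) :
    qPoch a p (m + n) = qPoch a p m * qPoch (a * p ^ m) p n := by
  simp only [qPoch, Finset.prod_range_add, pow_add, mul_assoc]

lemma qPoch_mul_qPochInf (a : ℂ) (hp : ‖p‖ < 1) (n : ℕ) :
    qPoch a p n * qPochInf (a * p ^ n) p = qPochInf a p := by
  have hshift : Tendsto (fun m => qPoch a p (n + m)) atTop (𝓝 (qPochInf a p)) := by
    simpa only [add_comm n] using (tendsto_add_atTop_iff_nat n).2 (tendsto_qPoch a hp)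
  refine tendsto_nhds_unique ?_ hshift
  simpa only [qPoch_add] using (tendsto_qPoch (a * p ^ n) hp).const_mul (qPoch a p n)

lemma qPochInf_eq_one_sub_mul (a : ℂ) (hp : ‖p‖ < 1) :
    qPochInf a p = (1 - a) * qPochInf (a * p) p := by
  simpa [qPoch] using (qPoch_mul_qPochInf a hp 1).symm

lemma qPoch_mul_eq_prod (a p : ℂ) (m d : ℕ) :
    qPoch a p (m * d) = ∏ i ∈ Finset.range d, qPoch (a * p ^ i) (p ^ d) m := by
  induction m with
  | zero => simp
  | succ m ih =>
    simp only [qPoch_succ, Finset.prod_mul_distrib, ← ih, add_mul, one_mul, qPoch_add]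
    congr 1
    refine Finset.prod_congr rfl fun k _ => ?_
    rw [← pow_mul, mul_comm d m]
    ring

lemma qPochInf_eq_prod (a : ℂ) (hp : ‖p‖ < 1) {d : ℕ} (hd : d ≠ 0) :
    qPochInf a p = ∏ i ∈ Finset.range d, qPochInf (a * p ^ i) (p ^ d) := by
  have hlim : Tendsto (fun m : ℕ => qPoch a p (m * d)) atTop (𝓝 (qPochInf a p)) :=
    (tendsto_qPoch a hp).comp (tendsto_id.atTop_mul_const' (Nat.pos_of_ne_zero hd))
  refine tendsto_nhds_unique hlim ?_
  simp only [qPoch_mul_eq_prod]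
  exact tendsto_finsetProd _ fun i _ => tendsto_qPoch _ (norm_pow_lt_one hp hd)

lemma qPochInf_eq_mul (a : ℂ) (hp : ‖p‖ < 1) :
    qPochInf a p = qPochInf a (p ^ 2) * qPochInf (a * p) (p ^ 2) := by
  simpa [Finset.prod_range_succ] using qPochInf_eq_prod a hp two_ne_zero

lemma qPoch_two_mul (a p : ℂ) (m : ℕ) :
    qPoch a p (2 * m) = qPoch a (p ^ 2) m * qPoch (a * p) (p ^ 2) m := by
  simpa [Finset.prod_range_succ, mul_comm m] using qPoch_mul_eq_prod a p m 2

lemma qPoch_two_mul_add_one (a p : ℂ) (m : ℕ) :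
    qPoch a p (2 * m + 1) = qPoch a (p ^ 2) (m + 1) * qPoch (a * p) (p ^ 2) m := by
  rw [qPoch_succ, qPoch_two_mul, qPoch_succ, ← pow_mul]
  ring

lemma qPoch_mul_neg (a p : ℂ) (n : ℕ) :
    qPoch a p n * qPoch (-a) p n = qPoch (a ^ 2) (p ^ 2) n := by
  simp only [qPoch, ← Finset.prod_mul_distrib]
  refine Finset.prod_congr rfl fun k _ => ?_
  ring

lemma qPochInf_mul_neg (a : ℂ) (hp : ‖p‖ < 1) :
    qPochInf a p * qPochInf (-a) p = qPochInf (a ^ 2) (p ^ 2) := by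
  refine tendsto_nhds_unique ?_ (tendsto_qPoch (a ^ 2) (norm_pow_lt_one hp two_ne_zero))
  simpa only [qPoch_mul_neg] using (tendsto_qPoch a hp).mul (tendsto_qPoch (-a) hp)

end ShiftedFactorials

section Reciprocals

/-- The reciprocal `1 / (p; p)_n` for integral `n`. The value `0` at `n < 0` is the one forced by
`1 / (p; p)_{n-1} = (1 - p ^ n) / (p; p)_n` at `n = 0`; it lets sums over `ℕ` be taken over `ℤ`. -/
noncomputable def invQPoch (p : ℂ) (n : ℤ) : ℂ := if n < 0 then 0 else (qPoch p p n.toNat)⁻¹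

variable {p : ℂ}

lemma invQPoch_of_neg (p : ℂ) {n : ℤ} (hn : n < 0) : invQPoch p n = 0 := by simp [invQPoch, hn]

@[simp] lemma invQPoch_natCast (p : ℂ) (n : ℕ) : invQPoch p n = (qPoch p p n)⁻¹ := by
  simp [invQPoch]

@[simp] lemma invQPoch_zero (p : ℂ) : invQPoch p 0 = 1 := by simp [invQPoch]

lemma invQPoch_sub_one (hp : ‖p‖ < 1) (n : ℤ) :
    invQPoch p (n - 1) = (1 - p ^ n) * invQPoch p n := by
  rcases lt_trichotomy n 0 with hn | rfl | hn
  · rw [invQPoch_of_neg p hn, invQPoch_of_neg p (by lia), mul_zero]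
  · simp [invQPoch]
  · obtain ⟨m, rfl⟩ : ∃ m : ℕ, n = (m + 1 : ℕ) := ⟨(n - 1).toNat, by lia⟩
    rw [show ((m + 1 : ℕ) : ℤ) - 1 = m by lia, invQPoch_natCast, invQPoch_natCast, qPoch_succ,
      zpow_natCast, ← pow_succ', mul_inv]
    have := one_sub_ne_zero_of_norm_lt_one (norm_pow_lt_one hp m.succ_ne_zero)
    field_simp

lemma tendsto_invQPoch (hp : ‖p‖ < 1) :
    Tendsto (fun n : ℕ => invQPoch p n) atTop (𝓝 (qPochInf p p)⁻¹) := by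
  simpa only [invQPoch_natCast] using (tendsto_qPoch p hp).inv₀ (qPochInf_ne_zero hp hp)

lemma exists_norm_invQPoch_le (hp : ‖p‖ < 1) : ∃ C : ℝ, 0 ≤ C ∧ ∀ n, ‖invQPoch p n‖ ≤ C := by
  obtain ⟨C, hC⟩ := (tendsto_invQPoch hp).norm.bddAbove_range
  have hC_nonneg : 0 ≤ C := (norm_nonneg _).trans (hC ⟨0, rfl⟩)
  refine ⟨C, hC_nonneg, fun n => ?_⟩
  rcases lt_or_ge n 0 with hn | hn
  · rwa [invQPoch_of_neg p hn, norm_zero]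
  · lift n to ℕ using hn
    exact hC ⟨n, rfl⟩

lemma invQPoch_of_notMem_range (p : ℂ) {n : ℤ} (hn : n ∉ Set.range ((↑) : ℕ → ℤ)) :
    invQPoch p n = 0 :=
  invQPoch_of_neg p (by simpa using hn)

lemma tsum_invQPoch_mul (p : ℂ) (f : ℤ → ℂ) :
    ∑' n : ℤ, invQPoch p n * f n = ∑' n : ℕ, invQPoch p n * f n := by
  refine (Nat.cast_injective.tsum_eq fun n hn => ?_).symm
  by_contra hmem
  exact hn (by simp [invQPoch_of_notMem_range p hmem])

lemma summable_invQPoch_mul_iff {p : ℂ} {f : ℤ → ℂ} :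
    (Summable fun n : ℤ => invQPoch p n * f n) ↔ Summable fun n : ℕ => invQPoch p n * f n :=
  (Nat.cast_injective.summable_iff fun n hn => by
    rw [invQPoch_of_notMem_range p hn, zero_mul]).symm

end Reciprocals

section GaussianSeries

lemma summable_norm_pow_mul_pow_sq {𝕜 : Type*} [NormedField 𝕜] (z : 𝕜) {y : 𝕜} (hy : ‖y‖ < 1) :
    Summable fun n : ℕ => ‖z ^ n * y ^ n ^ 2‖ := by
  have hratio : Tendsto (fun n : ℕ => ‖z‖ * ‖y‖ ^ n) atTop (𝓝 0) := by
    simpa using (tendsto_pow_atTop_nhds_zero_of_lt_one (norm_nonneg y) hy).const_mul ‖z‖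
  refine summable_of_isBigO_nat (summable_geometric_of_lt_one (r := 1 / 2) (by norm_num)
    (by norm_num)) (Asymptotics.IsBigO.of_bound 1 ?_)
  filter_upwards [hratio.eventually (gt_mem_nhds one_half_pos)] with n hn
  rw [sq, pow_mul, ← mul_pow, one_mul, norm_norm, norm_pow, norm_mul, norm_pow, norm_pow,
    Real.norm_of_nonneg one_half_pos.le]
  exact pow_le_pow_left₀ (by positivity) hn.le n

variable {y : ℂ}

lemma summable_norm_zpow_quadratic (hy0 : y ≠ 0) (hy : ‖y‖ < 1) {k : ℤ} (hk : 0 < k) (e : ℤ) :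
    Summable fun n : ℤ => ‖y ^ (k * n ^ 2 + e * n)‖ := by
  have hgauss (z : ℂ) : Summable fun n : ℕ => ‖z ^ n * y ^ n ^ 2‖ :=
    summable_norm_pow_mul_pow_sq z hy
  have hbound (n : ℤ) : ‖y ^ (k * n ^ 2 + e * n)‖ ≤ ‖y ^ (n ^ 2 + e * n)‖ := by
    rw [norm_zpow, norm_zpow]
    exact zpow_le_zpow_right_of_le_one₀ (norm_pos_iff.2 hy0) hy.le (by nlinarith [sq_nonneg n])
  refine Summable.of_nonneg_of_le (fun _ => norm_nonneg _) hbound (.of_nat_of_neg ?_ ?_)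
  · refine (hgauss (y ^ e)).congr fun n => ?_
    rw [zpow_add₀ hy0, zpow_mul, mul_comm]
    norm_cast
  · refine (hgauss (y ^ (-e))).congr fun n => ?_
    rw [neg_sq, mul_neg, ← neg_mul, zpow_add₀ hy0, zpow_mul, mul_comm]
    norm_cast

end GaussianSeries

section Euler

variable {y : ℂ}

/-- The summand `z ^ n y ^ (n ^ 2) / (y²; y²)_n` of Euler's expansion of `(-z y; y²)_∞`. -/
noncomputable def eulerTerm (z y : ℂ) (n : ℕ) : ℂ := invQPoch (y ^ 2) n * (z ^ n * y ^ n ^ 2)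

lemma summable_norm_eulerTerm (z : ℂ) (hy : ‖y‖ < 1) : Summable fun n => ‖eulerTerm z y n‖ := by
  obtain ⟨C, -, hC⟩ := exists_norm_invQPoch_le (norm_pow_lt_one hy two_ne_zero)
  refine .of_nonneg_of_le (fun _ => norm_nonneg _) (fun n => ?_)
    ((summable_norm_pow_mul_pow_sq z hy).mul_left C)
  rw [eulerTerm, norm_mul]
  exact mul_le_mul_of_nonneg_right (hC n) (norm_nonneg _)

lemma eulerTerm_succ_sub (z : ℂ) (hy : ‖y‖ < 1) (n : ℕ) :
    eulerTerm z y (n + 1) - eulerTerm (z * y ^ 2) y (n + 1) =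
      z * y * eulerTerm (z * y ^ 2) y n := by
  have hrec := invQPoch_sub_one (norm_pow_lt_one hy two_ne_zero) (n + 1 : ℕ)
  rw [show ((n + 1 : ℕ) : ℤ) - 1 = n by lia, zpow_natCast] at hrec
  rw [eulerTerm, eulerTerm, eulerTerm, hrec]
  ring

lemma tsum_eulerTerm_eq_one_add_mul (z : ℂ) (hy : ‖y‖ < 1) :
    ∑' n, eulerTerm z y n = (1 + z * y) * ∑' n, eulerTerm (z * y ^ 2) y n := by
  have hz := (summable_norm_eulerTerm z hy).of_norm
  have hz' := (summable_norm_eulerTerm (z * y ^ 2) hy).of_norm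
  have hdiff : ∑' n, eulerTerm z y n - ∑' n, eulerTerm (z * y ^ 2) y n =
      z * y * ∑' n, eulerTerm (z * y ^ 2) y n := by
    rw [← hz.tsum_sub hz', (hz.sub hz').tsum_eq_zero_add, ← tsum_mul_left]
    simp only [eulerTerm_succ_sub z hy]
    simp [eulerTerm]
  linear_combination hdiff

lemma tsum_eulerTerm_eq_qPoch_mul (z : ℂ) (hy : ‖y‖ < 1) (m : ℕ) :
    ∑' n, eulerTerm z y n =
      qPoch (-(z * y)) (y ^ 2) m * ∑' n, eulerTerm (z * (y ^ 2) ^ m) y n := by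
  induction m with
  | zero => simp
  | succ m ih =>
    rw [ih, tsum_eulerTerm_eq_one_add_mul _ hy, qPoch_succ, pow_succ (y ^ 2) m, ← mul_assoc z]
    ring

lemma tendsto_tsum_eulerTerm_mul_pow (z : ℂ) (hy : ‖y‖ < 1) :
    Tendsto (fun m : ℕ => ∑' n, eulerTerm (z * (y ^ 2) ^ m) y n) atTop (𝓝 1) := by
  have hp := norm_pow_lt_one hy two_ne_zero
  have hzero : ∑' n, eulerTerm (z * 0) y n = 1 := by
    rw [tsum_eq_single 0 fun n hn => by simp [eulerTerm, hn]]
    simp [eulerTerm]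
  rw [← hzero]
  refine tendsto_tsum_of_dominated_convergence (summable_norm_eulerTerm z hy) (fun n => ?_)
    (Eventually.of_forall fun m n => ?_)
  · have hpow := (tendsto_pow_atTop_nhds_zero_of_norm_lt_one hp).const_mul z
    exact ((hpow.pow n).mul_const _).const_mul _
  · simp only [eulerTerm, norm_mul, norm_pow]
    gcongr
    exact mul_le_of_le_one_right (norm_nonneg _)
      (pow_le_one₀ (by positivity) (pow_le_one₀ (norm_nonneg _) hy.le))

theorem tsum_eulerTerm (z : ℂ) (hy : ‖y‖ < 1) :
    ∑' n, eulerTerm z y n = qPochInf (-(z * y)) (y ^ 2) := by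
  have hlim := (tendsto_qPoch (-(z * y)) (norm_pow_lt_one hy two_ne_zero)).mul
    (tendsto_tsum_eulerTerm_mul_pow z hy)
  rw [mul_one] at hlim
  exact tendsto_nhds_unique
    (tendsto_const_nhds.congr (tsum_eulerTerm_eq_qPoch_mul z hy)) hlim

end Euler

section Durfee

/-- The sum `∑ p ^ (m ^ 2 + c m) / ((p; p)_m (p; p)_{m+c})`, which classifies partitions by the
size of their Durfee rectangle of excess `c`. -/
noncomputable def durfee (p : ℂ) (c : ℤ) : ℂ :=
  ∑' m : ℤ, invQPoch p m * (invQPoch p (m + c) * p ^ (m ^ 2 + c * m))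

variable {p : ℂ}

lemma durfee_neg (p : ℂ) (c : ℤ) : durfee p (-c) = durfee p c := by
  rw [durfee, ← (Equiv.addRight c).tsum_eq, durfee]
  refine tsum_congr fun m => ?_
  rw [Equiv.coe_addRight, add_neg_cancel_right,
    show (m + c) ^ 2 + -c * (m + c) = m ^ 2 + c * m by ring]
  ring

lemma summable_invQPoch_mul_invQPoch_mul (hp : ‖p‖ < 1) {α : ℤ → ℂ}
    (hα : Summable fun n => ‖α n‖) (f g : ℤ → ℤ) :
    Summable fun n => invQPoch p (f n) * (invQPoch p (g n) * α n) := by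
  obtain ⟨C, hC_nonneg, hC⟩ := exists_norm_invQPoch_le hp
  refine .of_norm_bounded ((hα.mul_left C).mul_left C) fun n => ?_
  rw [norm_mul, norm_mul]
  gcongr <;> exact hC _

lemma durfee_sub_durfee_add_one (hp0 : p ≠ 0) (hp : ‖p‖ < 1) (c : ℤ) :
    durfee p c - durfee p (c + 1) = p ^ (c + 1) * (durfee p (c + 2) - durfee p (c + 1)) := by
  have hgauss (c : ℤ) : Summable fun m : ℤ => ‖p ^ (m ^ 2 + c * m)‖ := by
    simpa using summable_norm_zpow_quadratic hp0 hp one_pos c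
  have hsum (f g : ℤ → ℤ) (c : ℤ) :=
    summable_invQPoch_mul_invQPoch_mul hp (hgauss c) f g
  have hshift : p ^ (c + 1) * durfee p (c + 2) = ∑' m : ℤ,
      invQPoch p (m - 1) * (invQPoch p (m + (c + 1)) * p ^ (m ^ 2 + c * m)) := by
    rw [durfee, ← tsum_mul_left, ← (Equiv.subRight (1 : ℤ)).tsum_eq]
    refine tsum_congr fun m => ?_
    rw [Equiv.subRight_apply, show m - 1 + (c + 2) = m + (c + 1) by ring,
      show m ^ 2 + c * m = (c + 1) + ((m - 1) ^ 2 + (c + 2) * (m - 1)) by ring,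
      zpow_add₀ hp0 (c + 1)]
    ring
  rw [mul_sub, hshift, durfee, durfee, ← tsum_mul_left, ← (hsum _ _ _).tsum_sub (hsum _ _ _),
    ← (hsum _ _ _).tsum_sub ((hsum _ _ _).mul_left _)]
  refine tsum_congr fun m => ?_
  have hrec := invQPoch_sub_one hp (m + (c + 1))
  rw [show m + (c + 1) - 1 = m + c by ring] at hrec
  rw [invQPoch_sub_one hp m, hrec, show m ^ 2 + (c + 1) * m = (m ^ 2 + c * m) + m by ring,
    zpow_add₀ hp0 (m ^ 2 + c * m) m, zpow_add₀ hp0 m (c + 1)]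
  ring

lemma durfee_natCast (p : ℂ) (c : ℕ) : durfee p c =
    ∑' m : ℕ, invQPoch p m * (invQPoch p (c + m : ℕ) * (p ^ m ^ 2 * (p ^ m) ^ c)) := by
  rw [durfee, tsum_invQPoch_mul]
  refine tsum_congr fun m => ?_
  rw [← pow_mul, ← pow_add, add_comm c, mul_comm m]
  norm_cast

lemma tendsto_durfee (hp : ‖p‖ < 1) :
    Tendsto (fun c : ℕ => durfee p c) atTop (𝓝 (qPochInf p p)⁻¹) := by
  obtain ⟨C, hC_nonneg, hC⟩ := exists_norm_invQPoch_le hp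
  have hgauss : Summable fun m : ℕ => ‖p ^ m ^ 2‖ := by
    simpa using summable_norm_pow_mul_pow_sq 1 hp
  have hlimit : (qPochInf p p)⁻¹ = ∑' m : ℕ,
      invQPoch p m * ((qPochInf p p)⁻¹ * (p ^ m ^ 2 * if m = 0 then 1 else 0)) := by
    rw [tsum_eq_single 0 fun m hm => by simp [hm]]
    simp
  rw [hlimit]
  simp only [durfee_natCast]
  refine tendsto_tsum_of_dominated_convergence ((hgauss.mul_left C).mul_left C) (fun m => ?_)
    (Eventually.of_forall fun c m => ?_)
  · have hpow : Tendsto (fun c : ℕ => (p ^ m) ^ c) atTop (𝓝 (if m = 0 then 1 else 0)) := by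
      split_ifs with hm
      · simp [hm]
      · exact tendsto_pow_atTop_nhds_zero_of_norm_lt_one (norm_pow_lt_one hp hm)
    exact ((((tendsto_add_atTop_iff_nat m).2 (tendsto_invQPoch hp)).mul
      (hpow.const_mul _))).const_mul _
  · have hpow : ‖(p ^ m) ^ c‖ ≤ 1 := by
      rw [norm_pow, norm_pow]
      exact pow_le_one₀ (by positivity) (pow_le_one₀ (norm_nonneg _) hp.le)
    rw [norm_mul, norm_mul, norm_mul]
    exact mul_le_mul (hC _) (mul_le_mul (hC _) (mul_le_of_le_one_right (norm_nonneg _) hpow)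
      (by positivity) hC_nonneg) (by positivity) hC_nonneg

lemma durfee_natCast_add_one (hp0 : p ≠ 0) (hp : ‖p‖ < 1) (c : ℕ) :
    durfee p (c + 1 : ℕ) = durfee p c := by
  let δ (n : ℕ) : ℝ := ‖durfee p (n + 1 : ℕ) - durfee p n‖
  have hmono : Monotone δ := monotone_nat_of_le_succ fun n => by
    have hrec := durfee_sub_durfee_add_one hp0 hp n
    simp only [δ]
    rw [← norm_neg, neg_sub, Nat.cast_add_one, hrec, norm_mul]
    refine mul_le_of_le_one_left (norm_nonneg _) ?_ |>.trans_eq ?_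
    · exact_mod_cast (norm_pow_lt_one hp n.succ_ne_zero).le
    · push_cast
      ring_nf
  have hlim : Tendsto δ atTop (𝓝 0) := by
    simpa [δ] using (((tendsto_add_atTop_iff_nat 1).2 (tendsto_durfee hp)).sub
      (tendsto_durfee hp)).norm
  exact sub_eq_zero.1 (norm_le_zero_iff.1 (hmono.ge_of_tendsto hlim c))

theorem durfee_eq (hp0 : p ≠ 0) (hp : ‖p‖ < 1) (c : ℤ) : durfee p c = (qPochInf p p)⁻¹ := by
  have hconst (n : ℕ) : durfee p n = durfee p 0 := by
    induction n with
    | zero => rfl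
    | succ n ih => rw [durfee_natCast_add_one hp0 hp, ih]
  have hzero : durfee p 0 = (qPochInf p p)⁻¹ :=
    tendsto_nhds_unique (tendsto_const_nhds.congr fun n => (hconst n).symm) (tendsto_durfee hp)
  obtain ⟨n, rfl | rfl⟩ := c.eq_nat_or_neg
  · rw [hconst, hzero]
  · rw [durfee_neg, hconst, hzero]

end Durfee

section TripleProduct

variable {y : ℂ}

lemma summable_invQPoch_mul_zpow (z : ℂ) (hy : ‖y‖ < 1) :
    Summable fun n : ℤ => invQPoch (y ^ 2) n * (z ^ n * y ^ n ^ 2) := by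
  refine summable_invQPoch_mul_iff.2 ((summable_norm_eulerTerm z hy).of_norm.congr fun n => ?_)
  rw [eulerTerm]
  norm_cast

lemma tsum_invQPoch_mul_zpow (z : ℂ) (hy : ‖y‖ < 1) :
    ∑' n : ℤ, invQPoch (y ^ 2) n * (z ^ n * y ^ n ^ 2) = qPochInf (-(z * y)) (y ^ 2) := by
  rw [tsum_invQPoch_mul, ← tsum_eulerTerm z hy]
  refine tsum_congr fun n => ?_
  rw [eulerTerm]
  norm_cast

lemma zpow_mul_zpow_sq_add_mul_inv {z : ℂ} (hz : z ≠ 0) (hy0 : y ≠ 0) (r m : ℤ) :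
    z ^ (r + m) * y ^ (r + m) ^ 2 * (z⁻¹ ^ m * y ^ m ^ 2) =
      z ^ r * y ^ r ^ 2 * (y ^ 2) ^ (m ^ 2 + r * m) := by
  have hy_exp : y ^ (r + m) ^ 2 * y ^ m ^ 2 = y ^ r ^ 2 * (y ^ 2) ^ (m ^ 2 + r * m) := by
    rw [← zpow_natCast y 2, ← zpow_mul, ← zpow_add₀ hy0, ← zpow_add₀ hy0]
    ring_nf
  rw [zpow_add₀ hz, inv_zpow]
  field_simp [zpow_ne_zero m hz]
  linear_combination hy_exp

theorem jacobi_triple_product {z : ℂ} (hz : z ≠ 0) (hy0 : y ≠ 0) (hy : ‖y‖ < 1) :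
    ∑' r : ℤ, z ^ r * y ^ r ^ 2 = qPochInf (-(z * y)) (y ^ 2) *
      qPochInf (-(z⁻¹ * y)) (y ^ 2) * qPochInf (y ^ 2) (y ^ 2) := by
  have hp := norm_pow_lt_one hy two_ne_zero
  have hz_sum := (summable_invQPoch_mul_zpow z hy).norm
  have hz'_sum := (summable_invQPoch_mul_zpow z⁻¹ hy).norm
  let e : ℤ × ℤ ≃ ℤ × ℤ :=
    (Equiv.prodComm ℤ ℤ).trans (Equiv.prodShear (Equiv.refl ℤ) Equiv.addRight)
  have hproduct : qPochInf (-(z⁻¹ * y)) (y ^ 2) * qPochInf (-(z * y)) (y ^ 2) =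
      ∑' r : ℤ, z ^ r * y ^ r ^ 2 * (qPochInf (y ^ 2) (y ^ 2))⁻¹ := by
    rw [← tsum_invQPoch_mul_zpow z hy, ← tsum_invQPoch_mul_zpow z⁻¹ hy,
      tsum_mul_tsum_of_summable_norm hz'_sum hz_sum, ← e.tsum_eq]
    refine ((e.summable_iff.2 (summable_mul_of_summable_norm hz'_sum hz_sum)).tsum_prod).trans
      (tsum_congr fun r => ?_)
    rw [← durfee_eq (pow_ne_zero 2 hy0) hp r, durfee, ← tsum_mul_left]
    refine tsum_congr fun m => ?_
    simp only [e, Equiv.trans_apply, Equiv.prodComm_apply, Equiv.prodShear_apply, Function.comp,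
      Prod.fst_swap, Prod.snd_swap, Equiv.refl_apply, Equiv.coe_addRight]
    rw [add_comm m r]
    linear_combination invQPoch (y ^ 2) m * invQPoch (y ^ 2) (r + m) *
      zpow_mul_zpow_sq_add_mul_inv hz hy0 r m
  rw [mul_comm (qPochInf (-(z * y)) _), hproduct, tsum_mul_right,
    inv_mul_cancel_right₀ (qPochInf_ne_zero hp hp)]

end TripleProduct

section Theta

/-- The summand of the theta series `∑ (-1) ^ r y ^ (k r ^ 2 + e r)`. -/
noncomputable def thetaTerm (y : ℂ) (k e r : ℤ) : ℂ := (-1) ^ r * y ^ (k * r ^ 2 + e * r)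

/-- The theta series `∑ (-1) ^ r y ^ (k r ^ 2 + e r)`, the sum side of Jacobi's triple product. -/
noncomputable def theta (y : ℂ) (k e : ℤ) : ℂ := ∑' r : ℤ, thetaTerm y k e r

variable {y : ℂ}

lemma thetaTerm_zero_right (y : ℂ) (k e : ℤ) : thetaTerm y k e 0 = 1 := by simp [thetaTerm]

lemma thetaTerm_neg (y : ℂ) (k e r : ℤ) : thetaTerm y k (-e) r = thetaTerm y k e (-r) := by
  rw [thetaTerm, thetaTerm, zpow_neg, ← inv_zpow, inv_neg_one, neg_sq, neg_mul_comm]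

lemma thetaTerm_sub_one (hy0 : y ≠ 0) (k e r : ℤ) :
    thetaTerm y k e (r - 1) = -y ^ (k - e) * thetaTerm y k (e - 2 * k) r := by
  rw [thetaTerm, thetaTerm, zpow_sub_one₀ (by norm_num), inv_neg_one,
    show k * (r - 1) ^ 2 + e * (r - 1) = (k - e) + (k * r ^ 2 + (e - 2 * k) * r) by ring,
    zpow_add₀ hy0]
  ring

lemma thetaTerm_add (hy0 : y ≠ 0) (k e l d r : ℤ) :
    thetaTerm y (k + l) (e + d) r = y ^ (l * r ^ 2 + d * r) * thetaTerm y k e r := by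
  rw [thetaTerm, thetaTerm,
    show (k + l) * r ^ 2 + (e + d) * r = (l * r ^ 2 + d * r) + (k * r ^ 2 + e * r) by ring,
    zpow_add₀ hy0]
  ring

lemma summable_norm_thetaTerm (hy0 : y ≠ 0) (hy : ‖y‖ < 1) {k : ℤ} (hk : 0 < k) (e : ℤ) :
    Summable fun r => ‖thetaTerm y k e r‖ := by
  simpa [thetaTerm] using summable_norm_zpow_quadratic hy0 hy hk e

theorem theta_eq_Jpair (hy0 : y ≠ 0) (hy : ‖y‖ < 1) {k e : ℕ} (hk : k ≠ 0) (hek : e ≤ k) :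
    theta y k e = Jpair y (k - e) (2 * k) := by
  have hjacobi := jacobi_triple_product (z := -y ^ e) (neg_ne_zero.2 (pow_ne_zero e hy0))
    (pow_ne_zero k hy0) (norm_pow_lt_one hy hk)
  have hplus : -(-y ^ e * y ^ k) = y ^ (2 * k - (k - e)) := by
    rw [show 2 * k - (k - e) = e + k by lia, pow_add, neg_mul, neg_neg]
  have hminus : -((-y ^ e)⁻¹ * y ^ k) = y ^ (k - e) := by
    rw [pow_sub₀ _ hy0 hek, inv_neg, neg_mul, neg_neg, mul_comm]
  rw [hplus, hminus, ← pow_mul, mul_comm k 2, mul_comm (qPochInf _ _)] at hjacobi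
  rw [Jpair, ← hjacobi, theta]
  refine tsum_congr fun r => ?_
  rw [thetaTerm, neg_eq_neg_one_mul (y ^ e), mul_zpow, ← zpow_natCast, ← zpow_natCast, ← zpow_mul,
    ← zpow_mul, mul_assoc, ← zpow_add₀ hy0, add_comm]

end Theta

section Bailey

/-- The sum `∑ α r / ((p; p)_{M - f r} (p; p)_{N + f r})`. For `M = n` and `N = n + d` it is the
`β n` of the Bailey pair whose `α`-sequence is `α`, supported on multiples of `f`. -/
noncomputable def baileySum (p : ℂ) (f : ℤ) (α : ℤ → ℂ) (M N : ℤ) : ℂ :=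
  ∑' r : ℤ, invQPoch p (M - f * r) * (invQPoch p (N + f * r) * α r)

variable {p y : ℂ} {f : ℤ} {α : ℤ → ℂ}

lemma baileySum_zero_zero (p : ℂ) (hf : f ≠ 0) (α : ℤ → ℂ) : baileySum p f α 0 0 = α 0 := by
  rw [baileySum, tsum_eq_single 0 fun r hr => ?_]
  · simp
  · rcases lt_or_gt_of_ne (mul_ne_zero hf hr) with h | h <;> simp [invQPoch_of_neg, h]

lemma baileySum_eq_zero_of_add_neg (p : ℂ) (f : ℤ) (α : ℤ → ℂ) {M N : ℤ} (hMN : M + N < 0) :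
    baileySum p f α M N = 0 := by
  refine (tsum_congr fun r => ?_).trans tsum_zero
  rcases lt_or_ge (M - f * r) 0 with hM | hM
  · rw [invQPoch_of_neg p hM, zero_mul]
  · rw [invQPoch_of_neg p (by lia : N + f * r < 0), zero_mul, mul_zero]

/-- The limiting case of Bailey's lemma in which both free parameters are sent to infinity. -/
theorem tsum_zpow_mul_baileySum (hp0 : p ≠ 0) (hp : ‖p‖ < 1) (hα : Summable fun r => ‖α r‖)
    (f d : ℤ) :
    ∑' n : ℤ, p ^ (n ^ 2 + d * n) * baileySum p f α n (n + d) =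
      (∑' r : ℤ, p ^ ((f * r) ^ 2 + d * (f * r)) * α r) * (qPochInf p p)⁻¹ := by
  obtain ⟨C, hC_nonneg, hC⟩ := exists_norm_invQPoch_le hp
  let T (n r : ℤ) : ℂ :=
    p ^ (n ^ 2 + d * n) * (invQPoch p (n - f * r) * (invQPoch p (n + d + f * r) * α r))
  have hT : Summable (Function.uncurry T) := by
    have hgauss : Summable fun n : ℤ => ‖p ^ (n ^ 2 + d * n)‖ := by
      simpa using summable_norm_zpow_quadratic hp0 hp one_pos d
    refine .of_norm_bounded (hgauss.mul_of_nonneg ((hα.mul_left C).mul_left C)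
      (fun _ => norm_nonneg _) fun _ => by positivity) fun x => ?_
    simp only [Function.uncurry, T, norm_mul]
    gcongr <;> exact hC _
  calc ∑' n : ℤ, p ^ (n ^ 2 + d * n) * baileySum p f α n (n + d)
      = ∑' n, ∑' r, T n r := tsum_congr fun n => by rw [baileySum, ← tsum_mul_left]
    _ = ∑' r, ∑' n, T n r := hT.tsum_comm.symm
    _ = ∑' r : ℤ, p ^ ((f * r) ^ 2 + d * (f * r)) * α r * durfee p (2 * (f * r) + d) := by
      refine tsum_congr fun r => ?_
      rw [durfee, ← tsum_mul_left, ← (Equiv.addRight (f * r)).tsum_eq]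
      refine tsum_congr fun n => ?_
      simp only [Equiv.coe_addRight, T]
      rw [add_sub_cancel_right, show n + f * r + d + f * r = n + (2 * (f * r) + d) by ring,
        show (n + f * r) ^ 2 + d * (n + f * r) = ((f * r) ^ 2 + d * (f * r)) +
          (n ^ 2 + (2 * (f * r) + d) * n) by ring, zpow_add₀ hp0]
      ring
    _ = _ := by simp only [durfee_eq hp0 hp, tsum_mul_right]

lemma baileySum_thetaTerm_neg (p y : ℂ) (f k e M N : ℤ) :
    baileySum p f (thetaTerm y k (-e)) M N = baileySum p f (thetaTerm y k e) N M := by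
  rw [baileySum, ← (Equiv.neg ℤ).tsum_eq, baileySum]
  refine tsum_congr fun r => ?_
  rw [Equiv.neg_apply, thetaTerm_neg, neg_neg, mul_neg, sub_neg_eq_add, ← sub_eq_add_neg]
  ring

lemma baileySum_thetaTerm_shift (p : ℂ) (hy0 : y ≠ 0) (f k e M N : ℤ) :
    baileySum p f (thetaTerm y k e) M N =
      -y ^ (k - e) * baileySum p f (thetaTerm y k (e - 2 * k)) (M + f) (N - f) := by
  rw [baileySum, ← (Equiv.subRight (1 : ℤ)).tsum_eq, baileySum, ← tsum_mul_left]
  refine tsum_congr fun r => ?_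
  rw [Equiv.subRight_apply, thetaTerm_sub_one hy0, show M - f * (r - 1) = M + f - f * r by ring,
    show N + f * (r - 1) = N - f + f * r by ring]
  ring

lemma baileySum_thetaTerm_self_eq_zero (p : ℂ) (hy0 : y ≠ 0) (f k n : ℤ) :
    baileySum p f (thetaTerm y k k) n (n + f) = 0 := by
  have hshift := baileySum_thetaTerm_shift p hy0 f k k n (n + f)
  rw [sub_self, zpow_zero, show k - 2 * k = -k by ring, add_sub_cancel_right,
    baileySum_thetaTerm_neg, neg_one_mul] at hshift
  exact self_eq_neg.1 hshift

lemma baileySum_thetaTerm_sub_one_left (hy0 : y ≠ 0) (hy : ‖y‖ < 1) {c : ℕ} (hc : c ≠ 0) {k : ℤ}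
    (hk : 0 < k) (f e M N : ℤ) :
    baileySum (y ^ c) f (thetaTerm y k e) (M - 1) N =
      baileySum (y ^ c) f (thetaTerm y k e) M N -
        (y ^ c) ^ M * baileySum (y ^ c) f (thetaTerm y k (e - c * f)) M N := by
  have hp := norm_pow_lt_one hy hc
  have hsum (e : ℤ) (g h : ℤ → ℤ) :=
    summable_invQPoch_mul_invQPoch_mul hp (summable_norm_thetaTerm hy0 hy hk e) g h
  rw [baileySum, baileySum, baileySum, ← tsum_mul_left,
    ← (hsum _ _ _).tsum_sub ((hsum _ _ _).mul_left _)]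
  refine tsum_congr fun r => ?_
  have hθ : (y ^ c) ^ M * thetaTerm y k (e - c * f) r =
      (y ^ c) ^ (M - f * r) * thetaTerm y k e r := by
    have := thetaTerm_add hy0 k e 0 (-(c * f)) r
    rw [add_zero, ← sub_eq_add_neg] at this
    rw [this, ← mul_assoc, ← zpow_natCast, ← zpow_mul, ← zpow_mul, ← zpow_add₀ hy0]
    ring_nf
  rw [show M - 1 - f * r = M - f * r - 1 by ring, invQPoch_sub_one hp]
  linear_combination invQPoch (y ^ c) (M - f * r) * invQPoch (y ^ c) (N + f * r) * hθ

lemma baileySum_thetaTerm_sub_one_right (hy0 : y ≠ 0) (hy : ‖y‖ < 1) {c : ℕ} (hc : c ≠ 0) {k : ℤ}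
    (hk : 0 < k) (f e M N : ℤ) :
    baileySum (y ^ c) f (thetaTerm y k e) M (N - 1) =
      baileySum (y ^ c) f (thetaTerm y k e) M N -
        (y ^ c) ^ N * baileySum (y ^ c) f (thetaTerm y k (e + c * f)) M N := by
  rw [← baileySum_thetaTerm_neg, baileySum_thetaTerm_sub_one_left hy0 hy hc hk,
    baileySum_thetaTerm_neg, ← neg_add', baileySum_thetaTerm_neg]

theorem tsum_pow_mul_baileySum_eq_Jpair (hy0 : y ≠ 0) (hy : ‖y‖ < 1) {c : ℕ} (hc : c ≠ 0) {k : ℤ}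
    (hk : 0 < k) (f e : ℤ) (d : ℕ)
    {K E : ℕ} (hK : k + c * f ^ 2 = K) (hE : e + c * f * d = E) (hK0 : K ≠ 0) (hEK : E ≤ K)
    (hneg : ∀ n : ℤ, n < 0 → baileySum (y ^ c) f (thetaTerm y k e) n (n + d) = 0) :
    ∑' n : ℕ, (y ^ c) ^ (n ^ 2 + d * n) * baileySum (y ^ c) f (thetaTerm y k e) n (n + d) =
      Jpair y (K - E) (2 * K) * (qPochInf (y ^ c) (y ^ c))⁻¹ := by
  have hθ : Jpair y (K - E) (2 * K) =
      ∑' r : ℤ, (y ^ c) ^ ((f * r) ^ 2 + d * (f * r)) * thetaTerm y k e r := by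
    rw [← theta_eq_Jpair hy0 hy hK0 hEK, ← hK, ← hE, theta]
    refine tsum_congr fun r => ?_
    rw [thetaTerm_add hy0, ← zpow_natCast y c, ← zpow_mul]
    ring_nf
  rw [hθ, ← tsum_zpow_mul_baileySum (pow_ne_zero c hy0) (norm_pow_lt_one hy hc)
    (summable_norm_thetaTerm hy0 hy hk e), ← (Nat.cast_injective (R := ℤ)).tsum_eq fun n hn => ?_]
  · refine tsum_congr fun n => ?_
    norm_cast
  · rcases lt_or_ge n 0 with h | h
    · exact absurd (mul_eq_zero_of_right _ (hneg n h)) hn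
    · exact ⟨n.toNat, Int.toNat_of_nonneg h⟩

end Bailey

section ClosedForms

variable {A B : ℕ → ℂ} {a p b r y : ℂ}

lemma mul_qPoch_mul_qPoch_eq_one (h0 : A 0 = 1) (hA : ∀ n, A n = (1 - a * p ^ n) * B n)
    (hB : ∀ n, B n = (1 - b * r ^ n) * A (n + 1)) (n : ℕ) :
    A n * (qPoch a p n * qPoch b r n) = 1 := by
  induction n with
  | zero => simp [h0]
  | succ n ih =>
    rw [hA, hB] at ih
    rw [← ih, qPoch_succ, qPoch_succ]
    ring

lemma eq_inv_qPoch_mul_qPoch (h0 : A 0 = 1) (hA : ∀ n, A n = (1 - a * p ^ n) * B n)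
    (hB : ∀ n, B n = (1 - b * r ^ n) * A (n + 1)) (n : ℕ) :
    A n = (qPoch a p n * qPoch b r n)⁻¹ :=
  eq_inv_of_mul_eq_one_left (mul_qPoch_mul_qPoch_eq_one h0 hA hB n)

lemma eq_inv_qPoch_succ_mul_qPoch (h0 : A 0 = 1) (hA : ∀ n, A n = (1 - a * p ^ n) * B n)
    (hB : ∀ n, B n = (1 - b * r ^ n) * A (n + 1)) (n : ℕ) :
    B n = (qPoch a p (n + 1) * qPoch b r n)⁻¹ := by
  refine eq_inv_of_mul_eq_one_left ?_
  rw [← mul_qPoch_mul_qPoch_eq_one h0 hA hB n, hA, qPoch_succ]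
  ring

lemma baileySum_rogersSelberg_self_eq_left (hy0 : y ≠ 0) (hy : ‖y‖ < 1) (n : ℤ) :
    baileySum (y ^ 4) 1 (thetaTerm y 3 1) n n =
      baileySum (y ^ 4) 1 (thetaTerm y 3 1) (n + 1) n := by
  have h := baileySum_thetaTerm_sub_one_left hy0 hy four_ne_zero three_pos 1 1 (n + 1) n
  have hzero := baileySum_thetaTerm_self_eq_zero (y ^ 4) hy0 1 3 n
  rw [← baileySum_thetaTerm_neg] at hzero
  norm_num at h
  rw [h, hzero, mul_zero, sub_zero]

lemma baileySum_rogersSelberg_self_eq_mul_right (hy0 : y ≠ 0) (hy : ‖y‖ < 1) (n : ℤ) :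
    baileySum (y ^ 4) 1 (thetaTerm y 3 1) n n =
      (1 + y ^ 2 * (y ^ 4) ^ n) * baileySum (y ^ 4) 1 (thetaTerm y 3 1) n (n + 1) := by
  have h := baileySum_thetaTerm_sub_one_right hy0 hy four_ne_zero three_pos 1 1 n (n + 1)
  have hshift := baileySum_thetaTerm_shift (y ^ 4) hy0 1 3 5 n (n + 1)
  norm_num at h hshift
  rw [baileySum_thetaTerm_neg] at hshift
  rw [h, hshift, zpow_add_one₀ (pow_ne_zero 4 hy0)]
  field_simp
  ring

lemma baileySum_rogersSelberg_right_eq_mul_add_one (hy0 : y ≠ 0) (hy : ‖y‖ < 1) (n : ℤ) :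
    baileySum (y ^ 4) 1 (thetaTerm y 3 1) n (n + 1) =
      (1 - (y ^ 8) ^ (n + 1)) * baileySum (y ^ 4) 1 (thetaTerm y 3 1) (n + 1) (n + 1) := by
  have hleft := baileySum_thetaTerm_sub_one_left hy0 hy four_ne_zero three_pos 1 1 (n + 1) (n + 1)
  have hright := baileySum_thetaTerm_sub_one_right hy0 hy four_ne_zero three_pos 1 (-3) (n + 1)
    (n + 1)
  have hzero := baileySum_thetaTerm_self_eq_zero (y ^ 4) hy0 1 3 n
  rw [← baileySum_thetaTerm_neg] at hzero
  norm_num at hleft hright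
  rw [hzero] at hright
  rw [hleft, sub_eq_zero.1 hright.symm, show y ^ 8 = y ^ 4 * y ^ 4 by ring, mul_zpow]
  ring

lemma baileySum_rogersMod14_right_eq_add_two (hy0 : y ≠ 0) (hy : ‖y‖ < 1) (n : ℤ) :
    baileySum y 2 (thetaTerm y 3 1) n (n + 1) = baileySum y 2 (thetaTerm y 3 1) n (n + 2) := by
  have h := baileySum_thetaTerm_sub_one_right hy0 hy one_ne_zero three_pos 2 1 n (n + 2)
  have hzero := baileySum_thetaTerm_self_eq_zero y hy0 2 3 n
  rw [show n + 2 - 1 = n + 1 by ring] at h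
  norm_num at h
  rw [h, hzero, mul_zero, sub_zero]

lemma baileySum_rogersMod14_self_eq_mul_right (hy0 : y ≠ 0) (hy : ‖y‖ < 1) (n : ℤ) :
    baileySum y 2 (thetaTerm y 3 1) n n =
      (1 - y * (y ^ 2) ^ n) * baileySum y 2 (thetaTerm y 3 1) n (n + 1) := by
  have h1 := baileySum_thetaTerm_sub_one_right hy0 hy one_ne_zero three_pos 2 1 n (n + 1)
  have h3 := baileySum_thetaTerm_sub_one_right hy0 hy one_ne_zero three_pos 2 3 n (n + 2)
  have hshift := baileySum_thetaTerm_shift y hy0 2 3 5 n (n + 2)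
  rw [show n + 2 - 1 = n + 1 by ring] at h3
  norm_num at h1 h3 hshift
  rw [baileySum_thetaTerm_neg, ← baileySum_rogersMod14_right_eq_add_two hy0 hy] at hshift
  have hpow : y * (y ^ 2) ^ n = y ^ (n + 1) * y ^ (n + 2) * (y ^ 2)⁻¹ := by
    rw [← zpow_natCast y 2, ← zpow_mul, ← zpow_neg, ← zpow_add₀ hy0, ← zpow_add₀ hy0,
      ← zpow_one_add₀ hy0]
    push_cast
    ring_nf
  rw [h1, h3, baileySum_thetaTerm_self_eq_zero y hy0, hshift, hpow]
  ring

lemma baileySum_rogersMod14_right_eq_mul_add_one (hy0 : y ≠ 0) (hy : ‖y‖ < 1) (n : ℤ) :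
    baileySum y 2 (thetaTerm y 3 1) n (n + 1) =
      (1 - y ^ (n + 1)) * baileySum y 2 (thetaTerm y 3 1) (n + 1) (n + 1) := by
  have h := baileySum_thetaTerm_sub_one_left hy0 hy one_ne_zero three_pos 2 1 (n + 1) (n + 1)
  norm_num at h
  rw [h, baileySum_thetaTerm_neg]
  ring

lemma baileySum_rogersSelberg_closedForm (hy0 : y ≠ 0) (hy : ‖y‖ < 1) (n : ℕ) :
    baileySum (y ^ 4) 1 (thetaTerm y 3 1) n n =
        (qPoch (-y ^ 2) (y ^ 4) n * qPoch (y ^ 8) (y ^ 8) n)⁻¹ ∧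
      baileySum (y ^ 4) 1 (thetaTerm y 3 1) n (n + 1) =
        (qPoch (-y ^ 2) (y ^ 4) (n + 1) * qPoch (y ^ 8) (y ^ 8) n)⁻¹ := by
  let A (n : ℕ) := baileySum (y ^ 4) 1 (thetaTerm y 3 1) n n
  let B (n : ℕ) := baileySum (y ^ 4) 1 (thetaTerm y 3 1) n (n + 1)
  have h0 : A 0 = 1 := by
    simp [A, baileySum_zero_zero _ one_ne_zero, thetaTerm_zero_right]
  have hA (n : ℕ) : A n = (1 - -y ^ 2 * (y ^ 4) ^ n) * B n := by
    rw [neg_mul, sub_neg_eq_add]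
    exact_mod_cast baileySum_rogersSelberg_self_eq_mul_right hy0 hy n
  have hB (n : ℕ) : B n = (1 - y ^ 8 * (y ^ 8) ^ n) * A (n + 1) := by
    rw [← pow_succ']
    exact_mod_cast baileySum_rogersSelberg_right_eq_mul_add_one hy0 hy n
  exact ⟨eq_inv_qPoch_mul_qPoch h0 hA hB n, eq_inv_qPoch_succ_mul_qPoch h0 hA hB n⟩

lemma baileySum_rogersMod14_closedForm (hy0 : y ≠ 0) (hy : ‖y‖ < 1) (n : ℕ) :
    baileySum y 2 (thetaTerm y 3 1) n n = (qPoch y (y ^ 2) n * qPoch y y n)⁻¹ ∧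
      baileySum y 2 (thetaTerm y 3 1) n (n + 1) =
        (qPoch y (y ^ 2) (n + 1) * qPoch y y n)⁻¹ := by
  let A (n : ℕ) := baileySum y 2 (thetaTerm y 3 1) n n
  let B (n : ℕ) := baileySum y 2 (thetaTerm y 3 1) n (n + 1)
  have h0 : A 0 = 1 := by
    simp [A, baileySum_zero_zero _ two_ne_zero, thetaTerm_zero_right]
  have hA (n : ℕ) : A n = (1 - y * (y ^ 2) ^ n) * B n := by
    exact_mod_cast baileySum_rogersMod14_self_eq_mul_right hy0 hy n
  have hB (n : ℕ) : B n = (1 - y * y ^ n) * A (n + 1) := by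
    rw [← pow_succ']
    exact_mod_cast baileySum_rogersMod14_right_eq_mul_add_one hy0 hy n
  exact ⟨eq_inv_qPoch_mul_qPoch h0 hA hB n, eq_inv_qPoch_succ_mul_qPoch h0 hA hB n⟩

end ClosedForms

section RogersIdentities

variable {q : ℂ}

lemma J_pow (q : ℂ) (d m : ℕ) : J (q ^ d) m = J q (d * m) := by
  rw [J, J, ← pow_mul]

lemma Jpair_pow (q : ℂ) (d a m : ℕ) : Jpair (q ^ d) a m = Jpair q (d * a) (d * m) := by
  simp only [Jpair, ← pow_mul, Nat.mul_sub]

lemma exists_sq_eq_and_norm_lt_one (hq0 : q ≠ 0) (hq : ‖q‖ < 1) :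
    ∃ y : ℂ, y ^ 2 = q ∧ y ≠ 0 ∧ ‖y‖ < 1 := by
  obtain ⟨y, rfl⟩ := IsAlgClosed.exists_pow_nat_eq q two_pos
  refine ⟨y, rfl, pow_ne_zero_iff two_ne_zero |>.1 hq0, ?_⟩
  rwa [norm_pow, pow_lt_one_iff_of_nonneg (norm_nonneg y) two_ne_zero] at hq

theorem rogersSelberg_sq (hq0 : q ≠ 0) (hq : ‖q‖ < 1) :
    ∑' n : ℕ, (q ^ 2) ^ n ^ 2 * (qPoch (-q) (q ^ 2) n * qPoch (q ^ 4) (q ^ 4) n)⁻¹ =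
      Jpair q 3 7 * (J q 2)⁻¹ := by
  obtain ⟨y, rfl, hy0, hy⟩ := exists_sq_eq_and_norm_lt_one hq0 hq
  have h := tsum_pow_mul_baileySum_eq_Jpair hy0 hy four_ne_zero three_pos 1 1 0 (K := 7) (E := 1)
    (by norm_num) (by norm_num) (by norm_num) (by norm_num)
    fun n hn => baileySum_eq_zero_of_add_neg _ _ _ (by lia)
  rw [Jpair_pow, J, ← pow_mul, ← pow_mul]
  simp only [Nat.cast_zero, add_zero, zero_mul] at h
  rw [← h]
  exact tsum_congr fun n => by rw [(baileySum_rogersSelberg_closedForm hy0 hy n).1, ← pow_mul y]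

theorem rogersSelberg_sq_add (hq0 : q ≠ 0) (hq : ‖q‖ < 1) :
    ∑' n : ℕ, (q ^ 2) ^ (n ^ 2 + n) * (qPoch (-q) (q ^ 2) n * qPoch (q ^ 4) (q ^ 4) n)⁻¹ =
      Jpair q 2 7 * (J q 2)⁻¹ := by
  obtain ⟨y, rfl, hy0, hy⟩ := exists_sq_eq_and_norm_lt_one hq0 hq
  have h := tsum_pow_mul_baileySum_eq_Jpair hy0 hy four_ne_zero three_pos 1 (-1) 1 (K := 7) (E := 3)
    (by norm_num) (by norm_num) (by norm_num) (by norm_num)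
    fun n hn => baileySum_eq_zero_of_add_neg _ _ _ (by lia)
  rw [Jpair_pow, J, ← pow_mul, ← pow_mul]
  simp only [Nat.cast_one, one_mul, baileySum_thetaTerm_neg,
    ← baileySum_rogersSelberg_self_eq_left hy0 hy] at h
  rw [← h]
  exact tsum_congr fun n => by rw [(baileySum_rogersSelberg_closedForm hy0 hy n).1, ← pow_mul y]

theorem rogersSelberg_sq_add_succ (hq0 : q ≠ 0) (hq : ‖q‖ < 1) :
    ∑' n : ℕ, (q ^ 2) ^ (n ^ 2 + n) * (qPoch (-q) (q ^ 2) (n + 1) * qPoch (q ^ 4) (q ^ 4) n)⁻¹ =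
      Jpair q 1 7 * (J q 2)⁻¹ := by
  obtain ⟨y, rfl, hy0, hy⟩ := exists_sq_eq_and_norm_lt_one hq0 hq
  have h := tsum_pow_mul_baileySum_eq_Jpair hy0 hy four_ne_zero three_pos 1 1 1 (K := 7) (E := 5)
    (by norm_num) (by norm_num) (by norm_num) (by norm_num)
    fun n hn => baileySum_eq_zero_of_add_neg _ _ _ (by lia)
  rw [Jpair_pow, J, ← pow_mul, ← pow_mul]
  simp only [Nat.cast_one, one_mul] at h
  rw [← h]
  exact tsum_congr fun n => by rw [(baileySum_rogersSelberg_closedForm hy0 hy n).2, ← pow_mul y]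

theorem rogersMod14_sq (hq0 : q ≠ 0) (hq : ‖q‖ < 1) :
    ∑' n : ℕ, q ^ n ^ 2 * (qPoch q (q ^ 2) n * qPoch q q n)⁻¹ = Jpair q 6 14 * (J q 1)⁻¹ := by
  have h := tsum_pow_mul_baileySum_eq_Jpair hq0 hq one_ne_zero three_pos 2 1 0 (K := 7) (E := 1)
    (by norm_num) (by norm_num) (by norm_num) (by norm_num)
    fun n hn => baileySum_eq_zero_of_add_neg _ _ _ (by lia)
  simp only [Nat.cast_zero, add_zero, zero_mul, pow_one] at h
  rw [J, pow_one, ← h]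
  exact tsum_congr fun n => by rw [(baileySum_rogersMod14_closedForm hq0 hq n).1]

theorem rogersMod14_sq_add (hq0 : q ≠ 0) (hq : ‖q‖ < 1) :
    ∑' n : ℕ, q ^ (n ^ 2 + n) * (qPoch q (q ^ 2) (n + 1) * qPoch q q n)⁻¹ =
      Jpair q 4 14 * (J q 1)⁻¹ := by
  have h := tsum_pow_mul_baileySum_eq_Jpair hq0 hq one_ne_zero three_pos 2 1 1 (K := 7) (E := 3)
    (by norm_num) (by norm_num) (by norm_num) (by norm_num)
    fun n hn => baileySum_eq_zero_of_add_neg _ _ _ (by lia)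
  simp only [Nat.cast_one, one_mul, pow_one] at h
  rw [J, pow_one, ← h]
  exact tsum_congr fun n => by rw [(baileySum_rogersMod14_closedForm hq0 hq n).2]

theorem rogersMod14_sq_add_two_mul (hq0 : q ≠ 0) (hq : ‖q‖ < 1) :
    ∑' n : ℕ, q ^ (n ^ 2 + 2 * n) * (qPoch q (q ^ 2) (n + 1) * qPoch q q n)⁻¹ =
      Jpair q 2 14 * (J q 1)⁻¹ := by
  have h := tsum_pow_mul_baileySum_eq_Jpair hq0 hq one_ne_zero three_pos 2 1 2 (K := 7) (E := 5)
    (by norm_num) (by norm_num) (by norm_num) (by norm_num) fun n hn => by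
      rw [pow_one]
      exact (baileySum_rogersMod14_right_eq_add_two hq0 hq n).symm.trans
        (baileySum_eq_zero_of_add_neg _ _ _ (by lia))
  simp only [Nat.cast_ofNat, pow_one, ← baileySum_rogersMod14_right_eq_add_two hq0 hq] at h
  rw [J, pow_one, ← h]
  exact tsum_congr fun n => by rw [(baileySum_rogersMod14_closedForm hq0 hq n).2]

end RogersIdentities

section AbsoluteConvergence

/-- The exponent of `q` in `termF`, as a quadratic form in the summation indices. -/
def exponent (i j k l : ℤ) : ℤ := i ^ 2 + j ^ 2 + k ^ 2 + l ^ 2 + (i - j - k) * l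

-- The least eigenvalue of `exponent` is `1 - √3 / 2 > 1 / 8`.
lemma sum_sq_le_eight_mul_exponent (i j k l : ℤ) :
    i ^ 2 + j ^ 2 + k ^ 2 + l ^ 2 ≤ 8 * exponent i j k l := by
  rw [exponent]
  nlinarith [sq_nonneg (7 * i + 4 * l), sq_nonneg (7 * j - 4 * l), sq_nonneg (7 * k - 4 * l),
    sq_nonneg l]

lemma termF_eq (u v w t q : ℂ) (i j k l : ℕ) : termF u v w t q (i, j, k, l) =
    u ^ i * v ^ j * w ^ k * t ^ l * q ^ exponent i j k l *
      (invQPoch (q ^ 2) i * invQPoch (q ^ 2) j * invQPoch (q ^ 2) k * invQPoch (q ^ 2) l) := by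
  simp only [termF, exponent, invQPoch_natCast, div_eq_mul_inv, mul_inv]

lemma norm_pow_eight_zpow_exponent_le {r : ℂ} (hr : ‖r‖ ≤ 1) (i j k l : ℕ) :
    ‖(r ^ 8) ^ exponent i j k l‖ ≤ ‖r ^ i ^ 2 * (r ^ j ^ 2 * (r ^ k ^ 2 * r ^ l ^ 2))‖ := by
  have h := sum_sq_le_eight_mul_exponent i j k l
  obtain ⟨E, hE⟩ := Int.eq_ofNat_of_zero_le (a := exponent i j k l) (by lia)
  rw [hE] at h ⊢
  rw [zpow_natCast, ← pow_mul, ← pow_add, ← pow_add, ← pow_add, norm_pow, norm_pow]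
  exact pow_le_pow_of_le_one (norm_nonneg r) hr (by lia)

theorem summable_termF (u v w t : ℂ) {q : ℂ} (hq : ‖q‖ < 1) : Summable (termF u v w t q) := by
  obtain ⟨C, hC_nonneg, hC⟩ := exists_norm_invQPoch_le (norm_pow_lt_one hq two_ne_zero)
  obtain ⟨r, rfl⟩ := IsAlgClosed.exists_pow_nat_eq q (n := 8) (by norm_num)
  have hr : ‖r‖ < 1 := by
    rwa [norm_pow, pow_lt_one_iff_of_nonneg (norm_nonneg r) (by norm_num)] at hq
  have hgauss (z : ℂ) := summable_norm_pow_mul_pow_sq z hr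
  refine .of_norm_bounded (((hgauss u).mul_norm ((hgauss v).mul_norm
    ((hgauss w).mul_norm (hgauss t)))).mul_right (C * C * C * C)) fun ⟨i, j, k, l⟩ => ?_
  have hinv : ‖invQPoch ((r ^ 8) ^ 2) i * invQPoch ((r ^ 8) ^ 2) j * invQPoch ((r ^ 8) ^ 2) k *
      invQPoch ((r ^ 8) ^ 2) l‖ ≤ C * C * C * C := by
    rw [norm_mul, norm_mul, norm_mul]
    gcongr <;> exact hC _
  rw [termF_eq, norm_mul, norm_mul]
  calc _ ≤ ‖u ^ i * v ^ j * w ^ k * t ^ l‖ *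
        ‖r ^ i ^ 2 * (r ^ j ^ 2 * (r ^ k ^ 2 * r ^ l ^ 2))‖ * (C * C * C * C) := by
        gcongr
        exact norm_pow_eight_zpow_exponent_le hr.le i j k l
    _ = _ := by
        rw [← norm_mul]
        congr 2
        ring

theorem F_swap (u v w t q : ℂ) : F u v w t q = F u w v t q := by
  let e : ℕ × ℕ × ℕ × ℕ ≃ ℕ × ℕ × ℕ × ℕ :=
    { toFun := fun (i, j, k, l) => (i, k, j, l)
      invFun := fun (i, j, k, l) => (i, k, j, l)
      left_inv := fun _ => rfl
      right_inv := fun _ => rfl }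
  rw [F, ← e.tsum_eq, F]
  refine tsum_congr fun ⟨i, j, k, l⟩ => ?_
  simp only [e, Equiv.coe_fn_mk]
  rw [termF_eq, termF_eq, show exponent i k j l = exponent i j k l by simp only [exponent]; ring]
  ring

lemma F_zero_right (u v w t : ℂ) : F u v w t 0 = 1 := by
  rw [F, tsum_eq_single (0, 0, 0, 0)]
  · simp [termF]
  · rintro ⟨i, j, k, l⟩ hn
    have hexp := sum_sq_le_eight_mul_exponent i j k l
    have hE : exponent i j k l ≠ 0 := fun hE => hn <| by
      simp only [Prod.mk.injEq]
      refine ⟨?_, ?_, ?_, ?_⟩ <;> nlinarith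
    rw [termF_eq, zero_zpow _ hE, mul_zero, zero_mul]

end AbsoluteConvergence

section Reduction

/-- The product `(-q ^ n; q²)_∞` for integral `n`. -/
noncomputable def qPochNeg (q : ℂ) (n : ℤ) : ℂ := qPochInf (-q ^ n) (q ^ 2)

/-- What remains of `termF (q ^ a) (q ^ b) (q ^ c) t q` after summation over `i`, `j`, `k`. -/
noncomputable def reducedTerm (q : ℂ) (a b c : ℤ) (t : ℂ) (l : ℕ) : ℂ :=
  eulerTerm t q l * (qPochNeg q (a + 1 + l) * (qPochNeg q (b + 1 - l) * qPochNeg q (c + 1 - l)))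

variable {q : ℂ}

lemma tsum_eulerTerm_zpow (hq0 : q ≠ 0) (hq : ‖q‖ < 1) (n : ℤ) :
    ∑' i, eulerTerm (q ^ n) q i = qPochNeg q (n + 1) := by
  rw [tsum_eulerTerm _ hq, qPochNeg, zpow_add_one₀ hq0]

lemma termF_zpow_eq (hq0 : q ≠ 0) (a b c : ℤ) (t : ℂ) (i j k l : ℕ) :
    termF (q ^ a) (q ^ b) (q ^ c) t q (i, j, k, l) =
      eulerTerm t q l * (eulerTerm (q ^ (a + l)) q i *
        (eulerTerm (q ^ (b - l)) q j * eulerTerm (q ^ (c - l)) q k)) := by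
  have hpow : (q ^ a) ^ i * (q ^ b) ^ j * (q ^ c) ^ k * q ^ exponent i j k l =
      q ^ l ^ 2 * ((q ^ (a + l)) ^ i * q ^ i ^ 2 * ((q ^ (b - l)) ^ j * q ^ j ^ 2) *
        ((q ^ (c - l)) ^ k * q ^ k ^ 2)) := by
    simp only [← zpow_natCast, ← zpow_mul, ← zpow_add₀ hq0, exponent]
    push_cast
    ring_nf
  rw [termF_eq, eulerTerm, eulerTerm, eulerTerm, eulerTerm]
  linear_combination t ^ l * (invQPoch (q ^ 2) i * invQPoch (q ^ 2) j * invQPoch (q ^ 2) k *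
    invQPoch (q ^ 2) l) * hpow

lemma tsum_termF_zpow (hq0 : q ≠ 0) (hq : ‖q‖ < 1) (a b c : ℤ) (t : ℂ) (l : ℕ) :
    ∑' x : ℕ × ℕ × ℕ, termF (q ^ a) (q ^ b) (q ^ c) t q (x.1, x.2.1, x.2.2, l) =
      reducedTerm q a b c t l := by
  have hsum (z : ℂ) := summable_norm_eulerTerm z hq
  simp only [termF_zpow_eq hq0]
  rw [tsum_mul_left, reducedTerm, show a + 1 + l = a + l + 1 by ring,
    show b + 1 - l = b - l + 1 by ring, show c + 1 - l = c - l + 1 by ring,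
    ← tsum_eulerTerm_zpow hq0 hq, ← tsum_eulerTerm_zpow hq0 hq, ← tsum_eulerTerm_zpow hq0 hq,
    tsum_mul_tsum_of_summable_norm (hsum _) (hsum _),
    tsum_mul_tsum_of_summable_norm (hsum _) ((hsum _).mul_norm (hsum _))]

theorem hasSum_reducedTerm (hq0 : q ≠ 0) (hq : ‖q‖ < 1) (a b c : ℤ) (t : ℂ) :
    HasSum (reducedTerm q a b c t) (F (q ^ a) (q ^ b) (q ^ c) t q) := by
  let e : ℕ × ℕ × ℕ × ℕ ≃ ℕ × ℕ × ℕ × ℕ :=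
    { toFun := fun (l, i, j, k) => (i, j, k, l)
      invFun := fun (i, j, k, l) => (l, i, j, k)
      left_inv := fun _ => rfl
      right_inv := fun _ => rfl }
  have hsum := e.summable_iff.2 (summable_termF (q ^ a) (q ^ b) (q ^ c) t hq)
  have hF := e.hasSum_iff.2 (summable_termF (q ^ a) (q ^ b) (q ^ c) t hq).hasSum
  refine hF.prod_fiberwise fun l => ?_
  rw [← tsum_termF_zpow hq0 hq]
  exact (hsum.prod_factor l).hasSum

lemma F_zpow_eq_even_add_odd (hq0 : q ≠ 0) (hq : ‖q‖ < 1) (a b c : ℤ) (t : ℂ) :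
    F (q ^ a) (q ^ b) (q ^ c) t q =
      ∑' m, reducedTerm q a b c t (2 * m) + ∑' m, reducedTerm q a b c t (2 * m + 1) := by
  have h := hasSum_reducedTerm hq0 hq a b c t
  have heven := h.summable.comp_injective (mul_right_injective₀ (two_ne_zero' ℕ))
  have hodd := h.summable.comp_injective
    ((add_left_injective 1).comp (mul_right_injective₀ (two_ne_zero' ℕ)))
  rw [← h.tsum_eq]
  exact (tsum_even_add_odd heven hodd).symm

lemma qPochNeg_eq_one_add_mul (hq0 : q ≠ 0) (hq : ‖q‖ < 1) (n : ℤ) :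
    qPochNeg q n = (1 + q ^ n) * qPochNeg q (n + 2) := by
  rw [qPochNeg, qPochInf_eq_one_sub_mul _ (norm_pow_lt_one hq two_ne_zero), qPochNeg,
    sub_neg_eq_add, neg_mul, zpow_add₀ hq0]
  norm_cast

lemma qPochNeg_zero (hq0 : q ≠ 0) (hq : ‖q‖ < 1) : qPochNeg q 0 = 2 * qPochNeg q 2 := by
  rw [qPochNeg_eq_one_add_mul hq0 hq, zpow_zero, one_add_one_eq_two, zero_add]

lemma qPoch_mul_qPochNeg_add (hq0 : q ≠ 0) (hq : ‖q‖ < 1) (n : ℤ) (m : ℕ) :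
    qPoch (-q ^ n) (q ^ 2) m * qPochNeg q (n + 2 * m) = qPochNeg q n := by
  rw [qPochNeg, qPochNeg, ← qPoch_mul_qPochInf (-q ^ n) (norm_pow_lt_one hq two_ne_zero) m,
    zpow_add₀ hq0, zpow_mul, neg_mul]
  norm_cast

lemma qPochNeg_sub (hq0 : q ≠ 0) (hq : ‖q‖ < 1) (n : ℤ) (m : ℕ) :
    qPochNeg q (n - 2 * m) =
      q ^ (n * m - m ^ 2 - m) * qPoch (-q ^ (2 - n)) (q ^ 2) m * qPochNeg q n := by
  induction m with
  | zero => simp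
  | succ m ih =>
    have hfactor : 1 + q ^ (n - 2 * (m + 1)) =
        q ^ (n - 2 * (m + 1)) * (1 - -q ^ (2 - n) * (q ^ 2) ^ m) := by
      have : q ^ (n - 2 * (m + 1)) * (q ^ (2 - n) * (q ^ 2) ^ m) = 1 := by
        rw [← zpow_natCast q 2, ← zpow_natCast, ← zpow_mul, ← zpow_add₀ hq0, ← zpow_add₀ hq0]
        push_cast
        ring_nf
        exact zpow_zero q
      linear_combination -this
    push_cast
    rw [qPochNeg_eq_one_add_mul hq0 hq, show n - 2 * (m + 1 : ℤ) + 2 = n - 2 * m by ring, ih,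
      hfactor, qPoch_succ, show n * (m + 1 : ℤ) - (m + 1) ^ 2 - (m + 1) =
        (n * m - m ^ 2 - m) + (n - 2 * (m + 1)) by ring, zpow_add₀ hq0 (n * m - m ^ 2 - m)]
    ring

/-- `n ↦ (-q ^ n, -q ^ (2 - n); q²)_∞` is a theta function, hence quasi-periodic in `n`. -/
lemma qPochNeg_add_mul_qPochNeg_sub (hq0 : q ≠ 0) (hq : ‖q‖ < 1) (n : ℤ) (m : ℕ) :
    qPochNeg q (n + 2 * m) * qPochNeg q (2 - n - 2 * m) =
      q ^ (m - n * m - m ^ 2) * (qPochNeg q n * qPochNeg q (2 - n)) := by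
  rw [qPochNeg_sub hq0 hq, sub_sub_cancel, ← qPoch_mul_qPochNeg_add hq0 hq n m,
    show (2 - n) * m - m ^ 2 - m = m - n * m - (m : ℤ) ^ 2 by ring]
  ring

end Reduction

section ParitySplit

variable {q : ℂ}

lemma qPoch_sq_two_mul (q : ℂ) (m : ℕ) :
    qPoch (q ^ 2) (q ^ 2) (2 * m) = qPoch (q ^ 2) (q ^ 4) m * qPoch (q ^ 4) (q ^ 4) m := by
  rw [qPoch_two_mul, ← sq, ← pow_mul]

lemma qPoch_sq_two_mul_add_one (q : ℂ) (m : ℕ) : qPoch (q ^ 2) (q ^ 2) (2 * m + 1) =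
    qPoch (q ^ 2) (q ^ 4) (m + 1) * qPoch (q ^ 4) (q ^ 4) m := by
  rw [qPoch_two_mul_add_one, ← sq, ← pow_mul]

lemma qPoch_sq_four (q : ℂ) (m : ℕ) :
    qPoch (q ^ 2) (q ^ 4) m = qPoch (-q) (q ^ 2) m * qPoch q (q ^ 2) m := by
  rw [mul_comm, qPoch_mul_neg, ← pow_mul]

lemma qPoch_four_four (q : ℂ) (m : ℕ) :
    qPoch (q ^ 4) (q ^ 4) m = qPoch (-q ^ 2) (q ^ 2) m * qPoch (q ^ 2) (q ^ 2) m := by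
  rw [mul_comm, qPoch_mul_neg, ← pow_mul]

lemma reducedTerm_eq (hq0 : q ≠ 0) (hq : ‖q‖ < 1) {a b c n n' : ℤ} {l m m' e : ℕ} {R : ℂ}
    (ha : a + 1 + l = n + 2 * m) (hb : b + 1 - l = 2 - n - 2 * m) (hc : c + 1 - l = n' - 2 * m')
    (he : l ^ 2 + (m - n * m - m ^ 2) + (n' * m' - m' ^ 2 - m') = e)
    (hR : qPoch (q ^ 2) (q ^ 2) l = qPoch (-q ^ (2 - n')) (q ^ 2) m' * R) (t : ℂ) :
    reducedTerm q a b c t l =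
      qPochNeg q n * qPochNeg q (2 - n) * qPochNeg q n' * (t ^ l * (q ^ e * R⁻¹)) := by
  have hp := norm_pow_lt_one hq two_ne_zero
  have hne := left_ne_zero_of_mul (hR ▸ qPoch_ne_zero hp hp l)
  have hpow : q ^ e = q ^ l ^ 2 * q ^ (m - n * m - m ^ 2) * q ^ (n' * m' - m' ^ 2 - m') := by
    rw [← zpow_natCast, ← he, zpow_add₀ hq0, zpow_add₀ hq0]
    norm_cast
  rw [reducedTerm, eulerTerm, invQPoch_natCast, hR, ha, hb, hc, ← mul_assoc (qPochNeg q _),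
    qPochNeg_add_mul_qPochNeg_sub hq0 hq, qPochNeg_sub hq0 hq, hpow]
  field_simp

lemma reducedTerm_zero_two_mul (hq0 : q ≠ 0) (hq : ‖q‖ < 1) (t : ℂ) (m : ℕ) :
    reducedTerm q 0 0 0 t (2 * m) = qPochNeg q 1 ^ 3 * (t ^ (2 * m) *
      ((q ^ 2) ^ m ^ 2 * (qPoch q (q ^ 2) m * qPoch (q ^ 4) (q ^ 4) m)⁻¹)) := by
  have hR : qPoch (q ^ 2) (q ^ 2) (2 * m) = qPoch (-q ^ (2 - 1 : ℤ)) (q ^ 2) m *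
      (qPoch q (q ^ 2) m * qPoch (q ^ 4) (q ^ 4) m) := by
    rw [qPoch_sq_two_mul, qPoch_sq_four, mul_assoc]
    norm_num
  rw [reducedTerm_eq hq0 hq (n := 1) (n' := 1) (m := m) (m' := m) (e := 2 * m ^ 2) (by lia)
    (by lia) (by lia) (by push_cast; ring) hR, pow_mul q,
    show (2 - 1 : ℤ) = 1 by norm_num]
  ring

lemma reducedTerm_zero_two_mul_add_one (hq0 : q ≠ 0) (hq : ‖q‖ < 1) (t : ℂ) (m : ℕ) :
    reducedTerm q 0 0 0 t (2 * m + 1) = 4 * t * q * qPochNeg q 2 ^ 3 * (t ^ (2 * m) *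
      ((q ^ 2) ^ (m ^ 2 + m) * (qPoch (q ^ 2) (q ^ 4) (m + 1) * qPoch (q ^ 2) (q ^ 2) m)⁻¹)) := by
  have hR : qPoch (q ^ 2) (q ^ 2) (2 * m + 1) = qPoch (-q ^ (2 - 0 : ℤ)) (q ^ 2) m *
      (qPoch (q ^ 2) (q ^ 4) (m + 1) * qPoch (q ^ 2) (q ^ 2) m) := by
    rw [qPoch_sq_two_mul_add_one, qPoch_four_four, mul_left_comm]
    norm_cast
  rw [reducedTerm_eq hq0 hq (n := 2) (n' := 0) (m := m) (m' := m) (e := 2 * (m ^ 2 + m) + 1)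
    (by lia) (by lia) (by lia) (by push_cast; ring) hR, pow_succ q, pow_mul q, sub_self,
    qPochNeg_zero hq0 hq]
  ring

lemma reducedTerm_neg_one_two_mul (hq0 : q ≠ 0) (hq : ‖q‖ < 1) (m : ℕ) :
    reducedTerm q (-1) 1 (-1) 1 (2 * m) = 4 * qPochNeg q 2 ^ 3 *
      ((q ^ 2) ^ m ^ 2 * (qPoch (q ^ 2) (q ^ 4) m * qPoch (q ^ 2) (q ^ 2) m)⁻¹) := by
  have hR : qPoch (q ^ 2) (q ^ 2) (2 * m) = qPoch (-q ^ (2 - 0 : ℤ)) (q ^ 2) m *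
      (qPoch (q ^ 2) (q ^ 4) m * qPoch (q ^ 2) (q ^ 2) m) := by
    rw [qPoch_sq_two_mul, qPoch_four_four, mul_left_comm]
    norm_cast
  rw [reducedTerm_eq hq0 hq (n := 0) (n' := 0) (m := m) (m' := m) (e := 2 * m ^ 2) (by lia)
    (by lia) (by lia) (by push_cast; ring) hR, pow_mul q, one_pow, sub_zero, qPochNeg_zero hq0 hq]
  ring

lemma reducedTerm_neg_one_two_mul_add_one (hq0 : q ≠ 0) (hq : ‖q‖ < 1) (m : ℕ) :
    reducedTerm q (-1) 1 (-1) 1 (2 * m + 1) = qPochNeg q 1 ^ 3 *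
      ((q ^ 2) ^ (m ^ 2 + m) * (qPoch q (q ^ 2) (m + 1) * qPoch (q ^ 4) (q ^ 4) m)⁻¹) := by
  have hR : qPoch (q ^ 2) (q ^ 2) (2 * m + 1) = qPoch (-q ^ (2 - 1 : ℤ)) (q ^ 2) (m + 1) *
      (qPoch q (q ^ 2) (m + 1) * qPoch (q ^ 4) (q ^ 4) m) := by
    rw [qPoch_sq_two_mul_add_one, qPoch_sq_four, mul_assoc]
    norm_num
  rw [reducedTerm_eq hq0 hq (n := 1) (n' := 1) (m := m) (m' := m + 1) (e := 2 * (m ^ 2 + m))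
    (by lia) (by lia) (by lia) (by push_cast; ring) hR, pow_mul q,
    show (2 - 1 : ℤ) = 1 by norm_num]
  ring

theorem F_one_one_one_eq (hq0 : q ≠ 0) (hq : ‖q‖ < 1) (t : ℂ) :
    F 1 1 1 t q =
      qPochNeg q 1 ^ 3 * ∑' m : ℕ, t ^ (2 * m) *
        ((q ^ 2) ^ m ^ 2 * (qPoch q (q ^ 2) m * qPoch (q ^ 4) (q ^ 4) m)⁻¹) +
      4 * t * q * qPochNeg q 2 ^ 3 * ∑' m : ℕ, t ^ (2 * m) *
        ((q ^ 2) ^ (m ^ 2 + m) * (qPoch (q ^ 2) (q ^ 4) (m + 1) * qPoch (q ^ 2) (q ^ 2) m)⁻¹) := by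
  have h := F_zpow_eq_even_add_odd hq0 hq 0 0 0 t
  rw [zpow_zero] at h
  rw [h, ← tsum_mul_left, ← tsum_mul_left]
  simp only [reducedTerm_zero_two_mul hq0 hq, reducedTerm_zero_two_mul_add_one hq0 hq]

theorem F_inv_self_inv_eq (hq0 : q ≠ 0) (hq : ‖q‖ < 1) :
    F q⁻¹ q q⁻¹ 1 q =
      4 * qPochNeg q 2 ^ 3 * ∑' m : ℕ,
        (q ^ 2) ^ m ^ 2 * (qPoch (q ^ 2) (q ^ 4) m * qPoch (q ^ 2) (q ^ 2) m)⁻¹ +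
      qPochNeg q 1 ^ 3 * ∑' m : ℕ,
        (q ^ 2) ^ (m ^ 2 + m) * (qPoch q (q ^ 2) (m + 1) * qPoch (q ^ 4) (q ^ 4) m)⁻¹ := by
  have h := F_zpow_eq_even_add_odd hq0 hq (-1) 1 (-1) 1
  rw [zpow_neg_one, zpow_one] at h
  rw [h, ← tsum_mul_left, ← tsum_mul_left]
  simp only [reducedTerm_neg_one_two_mul hq0 hq, reducedTerm_neg_one_two_mul_add_one hq0 hq]

end ParitySplit

section ProductEvaluation

variable {q : ℂ}

lemma J_ne_zero (hq : ‖q‖ < 1) {m : ℕ} (hm : m ≠ 0) : J q m ≠ 0 :=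
  qPochInf_ne_zero (norm_pow_lt_one hq hm) (norm_pow_lt_one hq hm)

lemma Jpair_ne_zero (hq : ‖q‖ < 1) {a m : ℕ} (ha : a ≠ 0) (ham : a < m) : Jpair q a m ≠ 0 := by
  have hm := norm_pow_lt_one hq (Nat.ne_zero_of_lt ham)
  exact mul_ne_zero (mul_ne_zero (qPochInf_ne_zero (norm_pow_lt_one hq ha) hm)
    (qPochInf_ne_zero (norm_pow_lt_one hq (Nat.sub_ne_zero_of_lt ham)) hm)) (qPochInf_ne_zero hm hm)

lemma Jpair_symm (q : ℂ) {a m : ℕ} (ham : a ≤ m) : Jpair q (m - a) m = Jpair q a m := by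
  rw [Jpair, Jpair, Nat.sub_sub_self ham, mul_comm (qPochInf (q ^ (m - a)) _)]

lemma qPochInf_pow_eq_mul (hq : ‖q‖ < 1) (a : ℕ) {m : ℕ} (hm : m ≠ 0) :
    qPochInf (q ^ a) (q ^ m) =
      qPochInf (q ^ a) (q ^ (2 * m)) * qPochInf (q ^ (a + m)) (q ^ (2 * m)) := by
  rw [qPochInf_eq_mul _ (norm_pow_lt_one hq hm), ← pow_add, ← pow_mul, mul_comm m]

lemma qPochInf_neg_pow_mul (hq : ‖q‖ < 1) (a : ℕ) {m : ℕ} (hm : m ≠ 0) :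
    qPochInf (-q ^ a) (q ^ m) * qPochInf (q ^ a) (q ^ m) =
      qPochInf (q ^ (2 * a)) (q ^ (2 * m)) := by
  rw [mul_comm, qPochInf_mul_neg _ (norm_pow_lt_one hq hm), ← pow_mul, ← pow_mul, mul_comm a,
    mul_comm m]

lemma Jpair_mul_J_two_mul_sq (hq : ‖q‖ < 1) {a m : ℕ} (ham : a ≤ m) (hm : m ≠ 0) :
    Jpair q a m * J q (2 * m) ^ 2 = Jpair q a (2 * m) * Jpair q (m - a) (2 * m) * J q m := by
  rw [Jpair, qPochInf_pow_eq_mul hq a hm, qPochInf_pow_eq_mul hq (m - a) hm, Jpair, Jpair,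
    show 2 * m - (m - a) = a + m by lia, show m - a + m = 2 * m - a by lia, J, J]
  ring

lemma qPochInf_neg_mul_Jpair (hq : ‖q‖ < 1) (a : ℕ) {m : ℕ} (hm : m ≠ 0) :
    qPochInf (-q ^ a) (q ^ m) * qPochInf (-q ^ (m - a)) (q ^ m) * (Jpair q a m * J q (2 * m)) =
      Jpair q (2 * a) (2 * m) * J q m := by
  rw [Jpair, Jpair, ← Nat.mul_sub, ← qPochInf_neg_pow_mul hq a hm,
    ← qPochInf_neg_pow_mul hq (m - a) hm, J, J]
  ring

lemma qPochInf_neg_right (a : ℂ) {p : ℂ} (hp : ‖p‖ < 1) :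
    qPochInf a (-p) = qPochInf a (p ^ 2) * qPochInf (-(a * p)) (p ^ 2) := by
  rw [qPochInf_eq_mul a (by rwa [norm_neg]), neg_sq, mul_neg]

lemma J_eq_qPochInf_mul_J (hq : ‖q‖ < 1) {m : ℕ} (hm : m ≠ 0) :
    J q m = qPochInf (q ^ m) (q ^ (2 * m)) * J q (2 * m) := by
  rw [J, qPochInf_pow_eq_mul hq m hm, ← two_mul, J]

lemma qPochInf_neg_pow_self (hq : ‖q‖ < 1) {m : ℕ} (hm : m ≠ 0) :
    qPochInf (-q ^ m) (q ^ m) = J q (2 * m) / J q m := by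
  rw [eq_div_iff (J_ne_zero hq hm), J, J, qPochInf_neg_pow_mul hq m hm]

lemma qPochInf_neg_pow_two_mul (hq : ‖q‖ < 1) {m : ℕ} (hm : m ≠ 0) :
    qPochInf (-q ^ m) (q ^ (2 * m)) = J q (2 * m) ^ 2 / (J q m * J q (4 * m)) := by
  have hne {n : ℕ} (hn : n ≠ 0) := J_ne_zero hq hn
  have h2m : 2 * m ≠ 0 := by lia
  have hodd := J_eq_qPochInf_mul_J hq h2m
  rw [← qPochInf_neg_pow_mul hq m h2m] at hodd
  rw [eq_div_iff (mul_ne_zero (hne hm) (hne (by lia))), J_eq_qPochInf_mul_J hq hm,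
    show 4 * m = 2 * (2 * m) by ring]
  linear_combination -J q (2 * m) * hodd

lemma Jpair_four_mul (hq : ‖q‖ < 1) {m : ℕ} (hm : m ≠ 0) :
    Jpair q m (4 * m) * J q (2 * m) = J q m * J q (4 * m) := by
  rw [J_eq_qPochInf_mul_J hq hm, qPochInf_pow_eq_mul hq m (show 2 * m ≠ 0 by lia), Jpair,
    show 4 * m - m = m + 2 * m by lia, show 2 * (2 * m) = 4 * m by ring, J, J]
  ring

lemma Jpair_neg_eq_mul (hq : ‖q‖ < 1) {b m : ℕ} (hb : Odd b) (hm : Odd m) (hbm : b ≤ m) :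
    Jpair (-q) b m =
      qPochInf (-q ^ b) (q ^ (2 * m)) * qPochInf (-q ^ (2 * m - b)) (q ^ (2 * m)) *
        Jpair q (m - b) (2 * m) * qPochInf (-q ^ m) (q ^ (2 * m)) := by
  have hp := norm_pow_lt_one hq hm.pos.ne'
  rw [Jpair, hb.neg_pow, hm.neg_pow, (Nat.Odd.sub_odd hm hb).neg_pow, qPochInf_neg_right _ hp,
    qPochInf_neg_right _ hp, qPochInf_neg_right _ hp, ← pow_mul, neg_mul, neg_mul, neg_neg,
    neg_neg, ← pow_add, ← pow_add, ← pow_add, ← two_mul, mul_comm m, Jpair,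
    show 2 * m - (m - b) = b + m by lia, show m - b + m = 2 * m - b by lia]
  ring

theorem Jpair_neg (hq : ‖q‖ < 1) {b m : ℕ} (hb : Odd b) (hm : Odd m) (hbm : b < m) :
    Jpair (-q) b m =
      J q (2 * m) ^ 2 * Jpair q (2 * b) (4 * m) * Jpair q (m - b) (4 * m) *
          Jpair q (m + b) (4 * m) /
        (J q (4 * m) * Jpair q b (4 * m) * Jpair q m (4 * m) * Jpair q (2 * m - b) (4 * m)) := by
  have hb0 := hb.pos.ne'
  have hm0 := hm.pos.ne'
  have h2m : 2 * m ≠ 0 := by lia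
  have hfour : 2 * (2 * m) = 4 * m := by ring
  have hJ {n : ℕ} (hn : n ≠ 0) := J_ne_zero hq hn
  have hJpair {a n : ℕ} (ha : a ≠ 0) (han : a < n) := Jpair_ne_zero hq ha han
  have hsplit := Jpair_mul_J_two_mul_sq hq (show b ≤ 2 * m by lia) h2m
  have hsplit' := Jpair_mul_J_two_mul_sq hq (show m - b ≤ 2 * m by lia) h2m
  have hneg := qPochInf_neg_mul_Jpair hq b h2m
  have hself := Jpair_four_mul hq hm0
  rw [hfour] at hsplit hsplit' hneg
  rw [show 2 * m - (m - b) = m + b by lia] at hsplit'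
  rw [← eq_div_iff (pow_ne_zero 2 (hJ (by lia)))] at hsplit hsplit'
  rw [← eq_div_iff (mul_ne_zero (hJpair hb0 (by lia)) (hJ (by lia))), hsplit] at hneg
  rw [← eq_div_iff (hJ h2m)] at hself
  rw [Jpair_neg_eq_mul hq hb hm hbm.le, hneg, hsplit', qPochInf_neg_pow_two_mul hq hm0, hself]
  have h1 := hJ hm0
  have h2 := hJ h2m
  have h3 := hJ (show 4 * m ≠ 0 by lia)
  have h4 := hJpair hb0 (show b < 4 * m by lia)
  have h5 := hJpair (show 2 * m - b ≠ 0 by lia) (show 2 * m - b < 4 * m by lia)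
  field_simp

lemma J_one_mul_J_pow (hq : ‖q‖ < 1) (m : ℕ) :
    J q 1 * J q (2 * (m + 1)) ^ m =
      J q (m + 1) * ∏ i ∈ Finset.range m, Jpair q (i + 1) (2 * (m + 1)) := by
  set N := 2 * (m + 1) with hN
  have hJone : J q 1 = ∏ i ∈ Finset.range N, qPochInf (q ^ (i + 1)) (q ^ N) := by
    rw [J, pow_one, qPochInf_eq_prod q hq (show N ≠ 0 by lia)]
    simp only [pow_succ']
  have hreflect : ∏ i ∈ Finset.range m, qPochInf (q ^ (N - (i + 1))) (q ^ N) =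
      ∏ i ∈ Finset.range m, qPochInf (q ^ (m + 1 + i + 1)) (q ^ N) := by
    rw [← Finset.prod_range_reflect]
    refine Finset.prod_congr rfl fun i hi => ?_
    have := Finset.mem_range.1 hi
    rw [show N - (m - 1 - i + 1) = m + 1 + i + 1 by lia]
  simp only [Jpair, Finset.prod_mul_distrib, Finset.prod_const, Finset.card_range, hreflect]
  rw [hJone, J_eq_qPochInf_mul_J hq m.succ_ne_zero, ← hN, show Finset.range N =
    Finset.range (m + 1 + m + 1) by congr 1; lia, Finset.prod_range_succ, Finset.prod_range_add,
    Finset.prod_range_succ, show m + 1 + m + 1 = N by lia, J]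
  ring

end ProductEvaluation

section ModulusTwentyEight

variable {q : ℂ}

lemma qPochNeg_one (hq : ‖q‖ < 1) : qPochNeg q 1 = J q 2 ^ 2 / (J q 1 * J q 4) := by
  simpa [qPochNeg] using qPochInf_neg_pow_two_mul hq one_ne_zero

lemma qPochNeg_two (hq : ‖q‖ < 1) : qPochNeg q 2 = J q 4 / J q 2 :=
  qPochInf_neg_pow_self hq two_ne_zero

lemma J_two_mul_J_pow (hq : ‖q‖ < 1) : J q 2 * J q 28 ^ 6 = J q 14 *
    (Jpair q 2 28 * Jpair q 4 28 * Jpair q 6 28 * Jpair q 8 28 * Jpair q 10 28 *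
      Jpair q 12 28) := by
  simpa [Finset.prod_range_succ, J_pow, Jpair_pow] using
    J_one_mul_J_pow (norm_pow_lt_one hq two_ne_zero) 6

lemma inv_J_two (hq : ‖q‖ < 1) : (J q 2)⁻¹ = J q 28 ^ 6 / (J q 14 *
    (Jpair q 2 28 * Jpair q 4 28 * Jpair q 6 28 * Jpair q 8 28 * Jpair q 10 28 *
      Jpair q 12 28)) := by
  rw [← J_two_mul_J_pow hq]
  have h2 := J_ne_zero hq two_ne_zero
  have h28 := J_ne_zero hq (show 28 ≠ 0 by norm_num)
  field_simp

lemma Jpair_neg_one_seven (hq : ‖q‖ < 1) :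
    Jpair (-q) 1 7 * (J q 2)⁻¹ = J q 14 * J q 28 ^ 5 /
      (Jpair q 1 28 * Jpair q 4 28 * Jpair q 7 28 * Jpair q 10 28 * Jpair q 12 28 *
        Jpair q 13 28) := by
  have hJ {n : ℕ} (hn : n ≠ 0) := J_ne_zero hq hn
  have hJpair {a : ℕ} (ha : a ≠ 0) (ha28 : a < 28) := Jpair_ne_zero hq ha ha28
  rw [Jpair_neg hq (by decide) (by decide) (by norm_num), inv_J_two hq]
  norm_num only
  field_simp (disch := first | exact hJ (by norm_num) | exact hJpair (by norm_num) (by norm_num))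

lemma Jpair_neg_three_seven (hq : ‖q‖ < 1) :
    Jpair (-q) 3 7 * (J q 2)⁻¹ = J q 14 * J q 28 ^ 5 /
      (Jpair q 2 28 * Jpair q 3 28 * Jpair q 7 28 * Jpair q 8 28 * Jpair q 11 28 *
        Jpair q 12 28) := by
  have hJ {n : ℕ} (hn : n ≠ 0) := J_ne_zero hq hn
  have hJpair {a : ℕ} (ha : a ≠ 0) (ha28 : a < 28) := Jpair_ne_zero hq ha ha28
  rw [Jpair_neg hq (by decide) (by decide) (by norm_num), inv_J_two hq]
  norm_num only
  field_simp (disch := first | exact hJ (by norm_num) | exact hJpair (by norm_num) (by norm_num))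

lemma Jpair_neg_two_seven (hq : ‖q‖ < 1) :
    Jpair (-q) 2 7 * (J q 2)⁻¹ = J q 14 * J q 28 ^ 5 /
      (Jpair q 4 28 * Jpair q 5 28 * Jpair q 6 28 * Jpair q 7 28 * Jpair q 8 28 *
        Jpair q 9 28) := by
  have hJ {n : ℕ} (hn : n ≠ 0) := J_ne_zero hq hn
  have hJpair {a : ℕ} (ha : a ≠ 0) (ha28 : a < 28) := Jpair_ne_zero hq ha ha28
  rw [← Jpair_symm (-q) (show 2 ≤ 7 by norm_num), Jpair_neg hq (by decide) (by decide)
    (by norm_num), inv_J_two hq]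
  norm_num only
  field_simp (disch := first | exact hJ (by norm_num) | exact hJpair (by norm_num) (by norm_num))

lemma qPochInf_zero_left (p : ℂ) : qPochInf 0 p = 1 := by simp [qPochInf]

lemma J_zero_left {m : ℕ} (hm : m ≠ 0) : J 0 m = 1 := by
  rw [J, zero_pow hm, qPochInf_zero_left]

lemma Jpair_zero_left {a m : ℕ} (ha : a ≠ 0) (ham : a < m) : Jpair 0 a m = 1 := by
  simp only [Jpair, zero_pow ha, zero_pow (Nat.sub_ne_zero_of_lt ham),
    zero_pow (Nat.ne_zero_of_lt ham), qPochInf_zero_left, one_mul]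

lemma J_neg_two (q : ℂ) : J (-q) 2 = J q 2 := by rw [J, J, neg_sq]

theorem F_one_one_one_one (hq : ‖q‖ < 1) :
    F 1 1 1 1 q =
      J q 2 ^ 6 * J q 14 * J q 28 ^ 5 / (J q 1 ^ 3 * J q 4 ^ 3 * Jpair q 2 28 * Jpair q 3 28 *
        Jpair q 7 28 * Jpair q 8 28 * Jpair q 11 28 * Jpair q 12 28) +
      4 * q * (J q 4 ^ 3 * Jpair q 8 28 / J q 2 ^ 4) := by
  rcases eq_or_ne q 0 with rfl | hq0
  · simp [F_zero_right, J_zero_left, Jpair_zero_left]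
  have hRS := rogersSelberg_sq (neg_ne_zero.2 hq0) (by rwa [norm_neg])
  have hmod14 := rogersMod14_sq_add (pow_ne_zero 2 hq0) (norm_pow_lt_one hq two_ne_zero)
  rw [neg_neg, neg_sq, Even.neg_pow (by decide), J_neg_two, Jpair_neg_three_seven hq] at hRS
  rw [← pow_mul q 2 2, J_pow, Jpair_pow] at hmod14
  rw [F_one_one_one_eq hq0 hq, qPochNeg_one hq, qPochNeg_two hq]
  simp only [one_pow, one_mul]
  rw [hRS, hmod14]
  ring

theorem F_one_one_one_self (hq : ‖q‖ < 1) :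
    F 1 1 1 q q =
      J q 2 ^ 6 * J q 14 * J q 28 ^ 5 / (J q 1 ^ 3 * J q 4 ^ 3 * Jpair q 4 28 * Jpair q 5 28 *
        Jpair q 6 28 * Jpair q 7 28 * Jpair q 8 28 * Jpair q 9 28) +
      4 * q ^ 2 * (J q 4 ^ 3 * Jpair q 4 28 / J q 2 ^ 4) := by
  rcases eq_or_ne q 0 with rfl | hq0
  · simp [F_zero_right, J_zero_left, Jpair_zero_left]
  have hRS := rogersSelberg_sq_add (neg_ne_zero.2 hq0) (by rwa [norm_neg])
  have hmod14 := rogersMod14_sq_add_two_mul (pow_ne_zero 2 hq0) (norm_pow_lt_one hq two_ne_zero)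
  rw [neg_neg, neg_sq, Even.neg_pow (by decide), J_neg_two, Jpair_neg_two_seven hq] at hRS
  rw [← pow_mul q 2 2, J_pow, Jpair_pow] at hmod14
  have hpow (m e : ℕ) : q ^ (2 * m) * (q ^ 2) ^ e = (q ^ 2) ^ (e + m) := by
    rw [pow_mul, ← pow_add, add_comm]
  rw [F_one_one_one_eq hq0 hq, qPochNeg_one hq, qPochNeg_two hq]
  simp only [← mul_assoc (q ^ (2 * _)), hpow, add_assoc, ← two_mul]
  rw [hRS, hmod14]
  ring

theorem F_inv_self_inv_one (hq0 : q ≠ 0) (hq : ‖q‖ < 1) :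
    F q⁻¹ q q⁻¹ 1 q =
      4 * (J q 4 ^ 3 * Jpair q 12 28 / J q 2 ^ 4) +
      J q 2 ^ 6 * J q 14 * J q 28 ^ 5 / (J q 1 ^ 3 * J q 4 ^ 3 * Jpair q 1 28 * Jpair q 4 28 *
        Jpair q 7 28 * Jpair q 10 28 * Jpair q 12 28 * Jpair q 13 28) := by
  have hRS := rogersSelberg_sq_add_succ (neg_ne_zero.2 hq0) (by rwa [norm_neg])
  have hmod14 := rogersMod14_sq (pow_ne_zero 2 hq0) (norm_pow_lt_one hq two_ne_zero)
  rw [neg_neg, neg_sq, Even.neg_pow (by decide), J_neg_two, Jpair_neg_one_seven hq] at hRS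
  rw [← pow_mul q 2 2, J_pow, Jpair_pow] at hmod14
  rw [F_inv_self_inv_eq hq0 hq, qPochNeg_one hq, qPochNeg_two hq, hRS, hmod14]
  ring

end ModulusTwentyEight

end QSeries

theorem mainTheorem3 (q : ℂ) (hq : ‖q‖ < 1) :
    (∀ u v w t : ℂ, Summable (QSeries.termF u v w t q)) ∧
    (∀ u v w t : ℂ, QSeries.F u v w t q = QSeries.F u w v t q) ∧
    QSeries.F 1 1 1 1 q =
      QSeries.J q 2 ^ 6 * QSeries.J q 14 * QSeries.J q 28 ^ 5 /
          (QSeries.J q 1 ^ 3 * QSeries.J q 4 ^ 3 *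
            QSeries.Jpair q 2 28 * QSeries.Jpair q 3 28 * QSeries.Jpair q 7 28 *
            QSeries.Jpair q 8 28 * QSeries.Jpair q 11 28 * QSeries.Jpair q 12 28) +
        4 * q * (QSeries.J q 4 ^ 3 * QSeries.Jpair q 8 28 / QSeries.J q 2 ^ 4) ∧
    QSeries.F 1 1 1 q q =
      QSeries.J q 2 ^ 6 * QSeries.J q 14 * QSeries.J q 28 ^ 5 /
          (QSeries.J q 1 ^ 3 * QSeries.J q 4 ^ 3 *
            QSeries.Jpair q 4 28 * QSeries.Jpair q 5 28 * QSeries.Jpair q 6 28 *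
            QSeries.Jpair q 7 28 * QSeries.Jpair q 8 28 * QSeries.Jpair q 9 28) +
        4 * q ^ 2 * (QSeries.J q 4 ^ 3 * QSeries.Jpair q 4 28 / QSeries.J q 2 ^ 4) ∧
    (q ≠ 0 →
      QSeries.F q⁻¹ q q⁻¹ 1 q =
        4 * (QSeries.J q 4 ^ 3 * QSeries.Jpair q 12 28 / QSeries.J q 2 ^ 4) +
          QSeries.J q 2 ^ 6 * QSeries.J q 14 * QSeries.J q 28 ^ 5 /
            (QSeries.J q 1 ^ 3 * QSeries.J q 4 ^ 3 *
              QSeries.Jpair q 1 28 * QSeries.Jpair q 4 28 * QSeries.Jpair q 7 28 *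
              QSeries.Jpair q 10 28 * QSeries.Jpair q 12 28 * QSeries.Jpair q 13 28)) :=
  ⟨fun u v w t => QSeries.summable_termF u v w t hq, fun u v w t => QSeries.F_swap u v w t q,
    QSeries.F_one_one_one_one hq, QSeries.F_one_one_one_self hq,
    fun hq0 => QSeries.F_inv_self_inv_one hq0 hq⟩
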